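/- For a graph $G=(V,E)$, a decomposition into balanced complete bipartite graphs is a list of complete bipartite subgraphs $G_i=(A_i,B_i,E_i)$ of $G$, with $A_i\cap B_i=\emptyset$ and $|A_i|=|B_i|\ge 1$, whose edge sets $E_i$ partition $E$. Its complexity is $\sum_i(|A_i|+|B_i|)$. Algorithm FIND-BIPARTITE, on a graph with $n$ vertices and $m$ edges, puts $$q=\left\lfloor\frac{\ln(n/2)}{\ln(2en^2/m)}\right\rfloor,\qquad r=\left\lfloor\frac{qn^2}{m}\right\rfloor,$$ lets $R$ be a set of $r$ vertices of highest degree, and goes through the $q$-element subsets $C$ of $R$. For each it computes $D=\bigcap_{v\in C}(N(v)\setminus R)$; as soon as $|D|\ge q$ it returns $(C,D')$, where $D'$ consists of the first $q$ elements of $D$. Algorithm FIND-DECOMPOSITION with threshold $n_0$, on an $n$-vertex graph $G$: if $n<n_0$, it finds a decomposition of $G$ into balanced complete bipartite graphs of minimum complexity by brute force. Otherwise, as long as the current graph has more than $n^2/\ln n$ edges, it applies FIND-BIPARTITE to the current graph and deletes the edges of the complete bipartite graph found; after that, each remaining edge forms a separate bipartite graph $K_{1,1}$. Theorem. For every sufficiently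 large constant $n_0$ there are a constant $C$ and a polynomial $p$ such that for every $n$ and every $n$-vertex graph $G$, given by its adjacency matrix, Algorithm FIND-DECOMPOSITION with threshold $n_0$ returns a decomposition of $G$ into balanced complete bipartite graphs, the complexity of this decomposition is at most $C\,n^2/\ln n$ if $n\ge 2$, and the algorithm takes at most $p(n)$ elementary steps. (Reading and writing a matrix entry, elementary list operations, additions and comparisons of integers, and the evaluation of $q$, of $r$ and of the test $m>n^2/\ln n$ each count as one step.) -/

import Mathlib

namespace Biclique

/-! ### Decompositions into balanced complete bipartite graphs -/

/-- The edge set of the complete bipartite graph with parts `K.1` and `K.2`. -/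
def edges {V : Type*} (K : Finset V × Finset V) : Set (Sym2 V) :=
  {e | ∃ a ∈ K.1, ∃ b ∈ K.2, e = s(a, b)}

/-- The complete bipartite graphs listed in `L` are balanced (with non-empty, disjoint parts),
and their edge sets partition the edge set of `G`. In particular each is a subgraph of `G`. -/
structure IsBalancedDecomposition {V : Type*} (G : SimpleGraph V)
    (L : List (Finset V × Finset V)) : Prop where
  nonempty : ∀ K ∈ L, K.1.Nonempty
  disjoint_parts : ∀ K ∈ L, Disjoint K.1 K.2
  balanced : ∀ K ∈ L, K.1.card = K.2.card
  edge_disjoint : L.Pairwise fun K K' => Disjoint (edges K) (edges K')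
  cover : ∀ e : Sym2 V, e ∈ G.edgeSet ↔ ∃ K ∈ L, e ∈ edges K

/-- The complexity of a decomposition: the total number of vertices of its members. -/
def complexity {V : Type*} (L : List (Finset V × Finset V)) : ℕ :=
  (L.map fun K => K.1.card + K.2.card).sum

/-! ### The arithmetic parameters of the algorithm -/

/-- `q(n, m) = ⌊ln (n / 2) / ln (2 e n² / m)⌋`. -/
noncomputable def qParam (n m : ℕ) : ℕ :=
  ⌊Real.log ((n : ℝ) / 2) / Real.log (2 * Real.exp 1 * (n : ℝ) ^ 2 / (m : ℝ))⌋₊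

/-- `r(n, m) = ⌊q(n, m) n² / m⌋`. -/
noncomputable def rParam (n m : ℕ) : ℕ :=
  ⌊(qParam n m : ℝ) * (n : ℝ) ^ 2 / (m : ℝ)⌋₊

open Classical in
/-- The test `m > n² / ln n`. -/
noncomputable def isDense (n m : ℕ) : Bool :=
  decide ((n : ℝ) ^ 2 / Real.log (n : ℝ) < (m : ℝ))

/-! ### The model of computation

A first-order programming language. Its data are natural numbers, truth values, vertices of the
input graph, adjacency matrices with random access, lists and pairs; its only loop is the loop over
the entries of a list. A program is a syntax tree, `Expr.val` is the result of its evaluation, and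
`Expr.cost` is the number of elementary steps that this evaluation takes. -/

/-- The data types of the language. -/
inductive Ty : Type
  | nat
  | bool
  | vertex
  | matrix
  | list (a : Ty)
  | prod (a b : Ty)

/-- Programs with result of a given type. Program variables of type `a` are elements of `rep a`;
as programs are polymorphic in `rep`, they can use a variable in no way except through the
constructors below, all of which are charged for. -/
inductive Expr (rep : Ty → Type) : Ty → Type
  /-- the content of a variable -/
  | var {a : Ty} (x : rep a) : Expr rep a
  /-- evaluate `e` once, store the result in a new variable, and continue -/
  | letE {a b : Ty} (e : Expr rep a) (f : rep a → Expr rep b) : Expr rep b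
  /-- `if b then s else t`; only the chosen branch is evaluated -/
  | ite {a : Ty} (b : Expr rep .bool) (s t : Expr rep a) : Expr rep a
  | tt : Expr rep .bool
  | ff : Expr rep .bool
  | lit (k : ℕ) : Expr rep .nat
  | add (s t : Expr rep .nat) : Expr rep .nat
  | lt (s t : Expr rep .nat) : Expr rep .bool
  | eq (s t : Expr rep .nat) : Expr rep .bool
  /-- the list `0, 1, ..., k - 1` -/
  | range (k : Expr rep .nat) : Expr rep (.list .nat)
  /-- the list of all vertices of the input graph -/
  | vertices : Expr rep (.list .vertex)
  /-- the number of a vertex -/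
  | index (v : Expr rep .vertex) : Expr rep .nat
  /-- the entry of a matrix in row `u` and column `v` -/
  | read (M : Expr rep .matrix) (u v : Expr rep .vertex) : Expr rep .bool
  /-- the matrix after overwriting the entry in row `u` and column `v` by `b` -/
  | write (M : Expr rep .matrix) (u v : Expr rep .vertex) (b : Expr rep .bool) : Expr rep .matrix
  | nil {a : Ty} : Expr rep (.list a)
  | cons {a : Ty} (x : Expr rep a) (l : Expr rep (.list a)) : Expr rep (.list a)
  | pair {a b : Ty} (x : Expr rep a) (y : Expr rep b) : Expr rep (.prod a b)
  | fst {a b : Ty} (p : Expr rep (.prod a b)) : Expr rep a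
  | snd {a b : Ty} (p : Expr rep (.prod a b)) : Expr rep b
  /-- `s := init; for x in l do s := f s x; return s` -/
  | foldl {a s : Ty} (l : Expr rep (.list a)) (init : Expr rep s)
      (f : rep s → rep a → Expr rep s) : Expr rep s
  /-- the arithmetic expressions `q(n, m)`, `r(n, m)` and `m > n² / ln n` -/
  | q (n m : Expr rep .nat) : Expr rep .nat
  | r (n m : Expr rep .nat) : Expr rep .nat
  | dense (n m : Expr rep .nat) : Expr rep .bool

/-- The data of each type, for an input graph with vertex set `Fin n`. -/
@[reducible] def Den (n : ℕ) : Ty → Type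
  | .nat => ℕ
  | .bool => Bool
  | .vertex => Fin n
  | .matrix => Fin n → Fin n → Bool
  | .list a => List (Den n a)
  | .prod a b => Den n a × Den n b

/-- The result of evaluating an expression. -/
noncomputable def Expr.val {n : ℕ} : {a : Ty} → Expr (Den n) a → Den n a
  | _, .var x => x
  | _, .letE e f => (f e.val).val
  | _, .ite b s t => bif b.val then s.val else t.val
  | _, .tt => true
  | _, .ff => false
  | _, .lit k => k
  | _, .add s t => s.val + t.val
  | _, .lt s t => decide (s.val < t.val)
  | _, .eq s t => decide (s.val = t.val)
  | _, .range k => List.range k.val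
  | _, .vertices => List.finRange n
  | _, .index v => (v.val : Fin n).val
  | _, .read M u v => M.val u.val v.val
  | _, .write M u v b => fun i j => if i = u.val ∧ j = v.val then b.val else M.val i j
  | _, .nil => []
  | _, .cons x l => x.val :: l.val
  | _, .pair x y => (x.val, y.val)
  | _, .fst p => p.val.1
  | _, .snd p => p.val.2
  | _, .foldl l init f => l.val.foldl (fun s x => (f s x).val) init.val
  | _, .q n m => qParam n.val m.val
  | _, .r n m => rParam n.val m.val
  | _, .dense n m => isDense n.val m.val

/-- The cost of a loop over a list that starts in state `s`, where one round in state `s` with list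
entry `x` leads to the state `step s x` and has cost `c s x`, plus one for moving on in the list. -/
def loopCost {α σ : Type} (step : σ → α → σ) (c : σ → α → ℕ) : σ → List α → ℕ
  | _, [] => 0
  | s, x :: l => 1 + c s x + loopCost step c (step s x) l

/-- The number of elementary steps of the evaluation of an expression: one step for every node of
the syntax tree each time that it is evaluated, and one more for each entry of a list that is
created by `range` or `vertices` or passed by a loop. -/
noncomputable def Expr.cost {n : ℕ} : {a : Ty} → Expr (Den n) a → ℕ
  | _, .var _ => 1
  | _, .letE e f => 1 + e.cost + (f e.val).cost
  | _, .ite b s t => 1 + b.cost + bif b.val then s.cost else t.cost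
  | _, .tt => 1
  | _, .ff => 1
  | _, .lit _ => 1
  | _, .add s t => 1 + s.cost + t.cost
  | _, .lt s t => 1 + s.cost + t.cost
  | _, .eq s t => 1 + s.cost + t.cost
  | _, .range k => 1 + k.cost + k.val
  | _, .vertices => 1 + n
  | _, .index v => 1 + v.cost
  | _, .read M u v => 1 + M.cost + u.cost + v.cost
  | _, .write M u v b => 1 + M.cost + u.cost + v.cost + b.cost
  | _, .nil => 1
  | _, .cons x l => 1 + x.cost + l.cost
  | _, .pair x y => 1 + x.cost + y.cost
  | _, .fst p => 1 + p.cost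
  | _, .snd p => 1 + p.cost
  | _, .foldl l init f =>
      1 + l.cost + init.cost +
        loopCost (fun s x => (f s x).val) (fun s x => (f s x).cost) init.val l.val
  | _, .q n m => 1 + n.cost + m.cost
  | _, .r n m => 1 + n.cost + m.cost
  | _, .dense n m => 1 + n.cost + m.cost

/-- A program with input of type `a` and output of type `b`: one syntax tree for all graphs. -/
def Program (a b : Ty) : Type 1 := ∀ rep : Ty → Type, rep a → Expr rep b

/-! ### Basic routines -/

section Routines

/-- Conjunction. -/
def andE {rep : Ty → Type} (s t : Expr rep .bool) : Expr rep .bool := .ite s t .ff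

/-- Disjunction. -/
def orE {rep : Ty → Type} (s t : Expr rep .bool) : Expr rep .bool := .ite s .tt t

/-- The number of entries of a list that satisfy `p`. -/
def countE {rep : Ty → Type} {a : Ty} (l : Expr rep (.list a)) (p : rep a → Expr rep .bool) :
    Expr rep .nat :=
  .foldl l (.lit 0) fun k x => .ite (p x) (.add (.var k) (.lit 1)) (.var k)

/-- The length of a list. -/
def lengthE {rep : Ty → Type} {a : Ty} (l : Expr rep (.list a)) : Expr rep .nat :=
  .foldl l (.lit 0) fun k _ => .add (.var k) (.lit 1)

/-- The reversed list. -/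
def reverseE {rep : Ty → Type} {a : Ty} (l : Expr rep (.list a)) : Expr rep (.list a) :=
  .foldl l .nil fun acc x => .cons (.var x) (.var acc)

/-- The list of the entries that satisfy `p`, in the original order. -/
def filterE {rep : Ty → Type} {a : Ty} (l : Expr rep (.list a)) (p : rep a → Expr rep .bool) :
    Expr rep (.list a) :=
  reverseE (.foldl l .nil fun acc x => .ite (p x) (.cons (.var x) (.var acc)) (.var acc))

/-- The first `k` entries of a list. -/
def takeE {rep : Ty → Type} {a : Ty} (k : rep .nat) (l : Expr rep (.list a)) :
    Expr rep (.list a) :=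
  reverseE (.foldl l .nil fun acc x =>
    .ite (.lt (lengthE (.var acc)) (.var k)) (.cons (.var x) (.var acc)) (.var acc))

/-- Do all entries of a list satisfy `p`? -/
def allE {rep : Ty → Type} {a : Ty} (l : Expr rep (.list a)) (p : rep a → Expr rep .bool) :
    Expr rep .bool :=
  .foldl l .tt fun b x => andE (.var b) (p x)

/-- Is the vertex `v` in the list `l`? -/
def memE {rep : Ty → Type} (v : rep .vertex) (l : Expr rep (.list .vertex)) : Expr rep .bool :=
  .foldl l .ff fun b x => orE (.var b) (.eq (.index (.var v)) (.index (.var x)))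

/-- Is `u < v` in the order of the vertices, and `uv` an edge? Each edge passes this test in
exactly one orientation. -/
def edgeE {rep : Ty → Type} (M : rep .matrix) (u v : rep .vertex) : Expr rep .bool :=
  andE (.lt (.index (.var u)) (.index (.var v))) (.read (.var M) (.var u) (.var v))

/-- The number of edges. -/
def numEdgesE {rep : Ty → Type} (M : rep .matrix) : Expr rep .nat :=
  .foldl .vertices (.lit 0) fun k u => .foldl .vertices (.var k) fun k v =>
    .ite (edgeE M u v) (.add (.var k) (.lit 1)) (.var k)

/-- The degree of `v`. -/
def degreeE {rep : Ty → Type} (M : rep .matrix) (v : rep .vertex) : Expr rep .nat :=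
  countE .vertices fun w => .read (.var M) (.var v) (.var w)

/-- The graph without the edges between `K.1` and `K.2`. -/
def deleteE {rep : Ty → Type} (M : Expr rep .matrix)
    (K : rep (.prod (.list .vertex) (.list .vertex))) : Expr rep .matrix :=
  .foldl (.fst (.var K)) M fun M a => .foldl (.snd (.var K)) (.var M) fun M b =>
    .write (.write (.var M) (.var a) (.var b) .ff) (.var b) (.var a) .ff

/-- The list `acc`, extended by a separate bipartite graph `({u}, {v})` for each edge `uv`. -/
def singleEdgesE {rep : Ty → Type} (M : rep .matrix)
    (acc : Expr rep (.list (.prod (.list .vertex) (.list .vertex)))) :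
    Expr rep (.list (.prod (.list .vertex) (.list .vertex))) :=
  .foldl .vertices acc fun acc u => .foldl .vertices (.var acc) fun acc v =>
    .ite (edgeE M u v)
      (.cons (.pair (.cons (.var u) .nil) (.cons (.var v) .nil)) (.var acc))
      (.var acc)

/-! ### FIND-BIPARTITE -/

/-- The number of vertices that precede `v` when the vertices are listed by decreasing degree, ties
being broken by the order of the vertices. -/
def rankE {rep : Ty → Type} (M : rep .matrix) (v : rep .vertex) : Expr rep .nat :=
  .letE (degreeE M v) fun dv => countE .vertices fun u => .letE (degreeE M u) fun du =>
    orE (.lt (.var dv) (.var du))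
      (andE (.eq (.var du) (.var dv)) (.lt (.index (.var u)) (.index (.var v))))

/-- `k` vertices having highest degree. -/
def topDegreeE {rep : Ty → Type} (M : rep .matrix) (k : rep .nat) : Expr rep (.list .vertex) :=
  filterE .vertices fun v => .lt (rankE M v) (.var k)

/-- All subsets of size `k` of a set `R` (given by a list without repetitions): going through `R`,
all subsets of size at most `k` are collected, and those of size `k` are kept. -/
def subsetsE {rep : Ty → Type} (k : rep .nat) (R : rep (.list .vertex)) :
    Expr rep (.list (.list .vertex)) :=
  filterE
    (.foldl (.var R) (.cons .nil .nil) fun acc x => .foldl (.var acc) (.var acc) fun acc' S =>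
      .ite (.lt (lengthE (.var S)) (.var k))
        (.cons (.cons (.var x) (.var S)) (.var acc')) (.var acc'))
    fun S => .eq (lengthE (.var S)) (.var k)

/-- The intersection of the sets `N(v) - R` over all `v` in `C`. -/
def commonE {rep : Ty → Type} (M : rep .matrix) (R C : rep (.list .vertex)) :
    Expr rep (.list .vertex) :=
  filterE .vertices fun w =>
    .ite (memE w (.var R)) .ff (allE (.var C) fun v => .read (.var M) (.var v) (.var w))

/-- FIND-BIPARTITE on a graph with `n` vertices and `m` edges. The result is the list with the
single entry `(C, D')` for the first `C` that succeeds, and the empty list if there is none. -/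
def findBipartite {rep : Ty → Type} (M : rep .matrix) (n m : rep .nat) :
    Expr rep (.list (.prod (.list .vertex) (.list .vertex))) :=
  .letE (.q (.var n) (.var m)) fun q =>
  .letE (.r (.var n) (.var m)) fun r =>
  .letE (topDegreeE M r) fun R =>
  .foldl (subsetsE q R) .nil fun res C =>
    .ite (.eq (lengthE (.var res)) (.lit 0))
      (.letE (commonE M R C) fun D =>
        .ite (.lt (lengthE (.var D)) (.var q)) .nil
          (.cons (.pair (.var C) (takeE q (.var D))) .nil))
      (.var res)

/-! ### The brute-force method for small graphs -/

/-- All sublists of a list. -/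
def sublistsE {rep : Ty → Type} {a : Ty} (l : Expr rep (.list a)) : Expr rep (.list (.list a)) :=
  .foldl l (.cons .nil .nil) fun acc x => .foldl (.var acc) (.var acc) fun acc' S =>
    .cons (.cons (.var x) (.var S)) (.var acc')

/-- All balanced complete bipartite subgraphs with non-empty parts. -/
def bicliquesE {rep : Ty → Type} (M : rep .matrix) :
    Expr rep (.list (.prod (.list .vertex) (.list .vertex))) :=
  .letE (sublistsE .vertices) fun P =>
  .foldl (.var P) .nil fun acc A => .foldl (.var P) (.var acc) fun acc B =>
    .ite
      (andE (.lt (.lit 0) (lengthE (.var A)))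
        (andE (.eq (lengthE (.var A)) (lengthE (.var B)))
          (allE (.var A) fun a => allE (.var B) fun b => .read (.var M) (.var a) (.var b))))
      (.cons (.pair (.var A) (.var B)) (.var acc)) (.var acc)

/-- Do the edge sets of the bipartite graphs in `L` partition the edge set of the graph? Their edges
are deleted one by one; each has to be present when it is deleted, and none may remain. -/
def checkE {rep : Ty → Type} (M : rep .matrix)
    (L : rep (.list (.prod (.list .vertex) (.list .vertex)))) : Expr rep .bool :=
  .letE
    (.foldl (.var L) (.pair (.var M) .tt) fun s K =>
      .foldl (.fst (.var K)) (.var s) fun s a => .foldl (.snd (.var K)) (.var s) fun s b =>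
        .ite (.read (.fst (.var s)) (.var a) (.var b))
          (.pair
            (.write (.write (.fst (.var s)) (.var a) (.var b) .ff) (.var b) (.var a) .ff)
            (.snd (.var s)))
          (.pair (.fst (.var s)) .ff))
    fun s => .letE (.fst (.var s)) fun M' =>
      andE (.snd (.var s)) (.eq (numEdgesE M') (.lit 0))

/-- The total number of vertices of the bipartite graphs in `L`. -/
def weightE {rep : Ty → Type} (L : rep (.list (.prod (.list .vertex) (.list .vertex)))) :
    Expr rep .nat :=
  .foldl (.var L) (.lit 0) fun k K =>
    .add (.var k) (.add (lengthE (.fst (.var K))) (lengthE (.snd (.var K))))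

/-- An optimal decomposition, by exhaustive search. -/
def bruteForce {rep : Ty → Type} (M : rep .matrix) :
    Expr rep (.list (.prod (.list .vertex) (.list .vertex))) :=
  .foldl (sublistsE (bicliquesE M)) (singleEdgesE M .nil) fun best L =>
    .ite (andE (checkE M L) (.lt (weightE L) (weightE best))) (.var L) (.var best)

/-! ### FIND-DECOMPOSITION -/

/-- FIND-DECOMPOSITION, with brute force on graphs with fewer than `n₀` vertices. The state of the
main loop consists of the current graph and the list of the subgraphs found so far. As each round
that finds a non-empty subgraph deletes an edge, the number of edges of the input graph bounds the
number of rounds. -/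
def findDecomposition (n₀ : ℕ) :
    Program .matrix (.list (.prod (.list .vertex) (.list .vertex))) := fun _ M =>
  .letE (lengthE .vertices) fun n =>
  .ite (.lt (.var n) (.lit n₀))
    (bruteForce M)
    (.letE
      (.foldl (.range (numEdgesE M)) (.pair (.var M) .nil) fun s _ =>
        .letE (.fst (.var s)) fun M =>
        .letE (numEdgesE M) fun m =>
        .ite (.dense (.var n) (.var m))
          (.foldl (findBipartite M n m) (.var s) fun s K =>
            .pair (deleteE (.fst (.var s)) K) (.cons (.var K) (.snd (.var s))))
          (.var s))
      fun s => .letE (.fst (.var s)) fun M => singleEdgesE M (.snd (.var s)))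

end Routines

/-! ### Running the algorithm on a graph -/

open Classical in
/-- The adjacency matrix that represents the input graph. -/
noncomputable def adjacency {n : ℕ} (G : SimpleGraph (Fin n)) : Den n .matrix :=
  fun u v => decide (G.Adj u v)

/-- The list of complete bipartite graphs that FIND-DECOMPOSITION returns for `G`. -/
noncomputable def output (n₀ : ℕ) {n : ℕ} (G : SimpleGraph (Fin n)) :
    List (Finset (Fin n) × Finset (Fin n)) :=
  (findDecomposition n₀ (Den n) (adjacency G)).val.map fun K => (K.1.toFinset, K.2.toFinset)

/-- The number of elementary steps of FIND-DECOMPOSITION on input `G`. -/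
noncomputable def runningTime (n₀ : ℕ) {n : ℕ} (G : SimpleGraph (Fin n)) : ℕ :=
  (findDecomposition n₀ (Den n) (adjacency G)).cost

end Biclique

/-! Why the bound holds. Put `A = 2en²`. A round on a graph with `m` edges adds `2q` to the
complexity and deletes `q²` edges, so each deleted edge costs `2/q`, which the choice of `q` makes
at most `4 log(A/m) / log(n/2)`. Summing over all edges deleted is dominated by the integral of
`log(A/t)`, that is by `potential A`, which never exceeds `A`. Formally, `log(n/2) * complexity + 4
* potential` does not increase in a round (`potential_sub_ge`, `mainLoop_spec`). The loop stops with
at most `n²/log n` edges, which cost 2 each (`findDecomposition_spec`).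

Why a round succeeds (`exists_biclique`). Let `d(w)` count the neighbours in `R` of a vertex `w`
outside `R`. If every `q`-subset of `R` had fewer than `q` common neighbours outside `R`, double
counting would give `∑ choose(d(w), q) ≤ (q-1) choose(r, q) ≤ n/2`. Since `d ≤ choose(d, q) + q -
1`, at most `n/2 + n(q-1)` edges would leave `R`. But `R` has the highest degrees, so its degree sum
is at least `2rm/n`, of which at most `r² ≤ n/2` stays inside `R`. Hence `2rm ≤ qn²`, which
contradicts `(r+1)m > qn²` and `2m ≤ n²`.

Why the time is polynomial. Only the enumeration of subsets of `R` is in doubt. Give a set `S` the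
weight `x^|S|` with `x = m/n²`; the total is at most `(1+x)^r ≤ e^q`, so at most `(e/x)^q ≤ n` sets
have size at most `q` (`length_collectSubsets_le`). Everything else is nested loops over lists of
polynomial length.

Below `n₀` there are finitely many graphs, so constants bound complexity and time there. Brute force
is correct because its result is the partition into single edges or a list that passed the check
(`bruteForce_spec`). -/

namespace Biclique

/-! ### The programs as functions on lists -/

section Evaluation

variable {n : ℕ} {a b : Ty}

/-- Loops build lists by prepending, so a filtering loop produces its entries in reverse order. -/
theorem foldl_cons_if {α β : Type*} (p : α → Bool) (f : α → β) (l : List α) (acc : List β) :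
    l.foldl (fun acc x => bif p x then f x :: acc else acc) acc =
      ((l.filter p).map f).reverse ++ acc := by
  induction l generalizing acc with
  | nil => simp
  | cons x l ih =>
    rw [List.foldl_cons, ih]
    cases h : p x <;> simp [h]

theorem foldl_count {α : Type*} (p : α → Bool) (l : List α) (k : ℕ) :
    l.foldl (fun k x => bif p x then k + 1 else k) k = k + l.countP p := by
  induction l generalizing k with
  | nil => simp
  | cons x l ih =>
    rw [List.foldl_cons, ih]
    cases h : p x <;> simp [h]; omega

theorem val_andE (s t : Expr (Den n) .bool) : (andE s t).val = (s.val && t.val) := by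
  simp only [andE, Expr.val]
  cases s.val <;> rfl

theorem val_orE (s t : Expr (Den n) .bool) : (orE s t).val = (s.val || t.val) := by
  simp only [orE, Expr.val]
  cases s.val <;> rfl

theorem val_countE (l : Expr (Den n) (.list a)) (p : Den n a → Expr (Den n) .bool) :
    (countE l p).val = l.val.countP fun x => (p x).val := by
  simp only [countE, Expr.val]
  rw [foldl_count (fun x => (p x).val)]; simp

theorem val_lengthE (l : Expr (Den n) (.list a)) : (lengthE l).val = l.val.length := by
  simp only [lengthE, Expr.val]
  simp

theorem val_reverseE (l : Expr (Den n) (.list a)) : (reverseE l).val = l.val.reverse := by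
  simp only [reverseE, Expr.val]
  simp

theorem val_filterE (l : Expr (Den n) (.list a)) (p : Den n a → Expr (Den n) .bool) :
    (filterE l p).val = l.val.filter fun x => (p x).val := by
  simp only [filterE, val_reverseE, Expr.val]
  have := foldl_cons_if (fun x => (p x).val) id l.val []
  simp only [id] at this
  rw [this]; simp

theorem foldl_take {α : Type*} (k : ℕ) (l acc : List α) (h : acc.length ≤ k) :
    l.foldl (fun acc x => bif decide (acc.length < k) then x :: acc else acc) acc =
      (l.take (k - acc.length)).reverse ++ acc := by
  induction l generalizing acc with
  | nil => simp
  | cons x l ih =>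
    rw [List.foldl_cons]
    by_cases hk : acc.length < k
    · simp only [hk, decide_true, cond_true]
      rw [ih _ (by simpa using hk)]
      obtain ⟨j, hj⟩ : ∃ j, k - acc.length = j + 1 := ⟨k - acc.length - 1, by omega⟩
      have : k - (x :: acc).length = j := by simp; omega
      rw [hj, this]; simp
    · simp only [hk, decide_false, cond_false]
      rw [ih _ h]
      have : k - acc.length = 0 := by omega
      simp [this]

theorem val_takeE (k : Den n .nat) (l : Expr (Den n) (.list a)) :
    (takeE k l).val = l.val.take k := by
  simp only [takeE, val_reverseE, Expr.val, val_lengthE]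
  rw [foldl_take _ _ _ (by simp)]; simp

theorem foldl_and {α : Type*} (p : α → Bool) (l : List α) (b : Bool) :
    l.foldl (fun b x => b && p x) b = (b && l.all p) := by
  induction l generalizing b with
  | nil => simp
  | cons x l ih => rw [List.foldl_cons, ih]; simp [Bool.and_assoc]

theorem foldl_or {α : Type*} (p : α → Bool) (l : List α) (b : Bool) :
    l.foldl (fun b x => b || p x) b = (b || l.any p) := by
  induction l generalizing b with
  | nil => simp
  | cons x l ih => rw [List.foldl_cons, ih]; simp [Bool.or_assoc]

theorem val_allE (l : Expr (Den n) (.list a)) (p : Den n a → Expr (Den n) .bool) :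
    (allE l p).val = l.val.all fun x => (p x).val := by
  simp only [allE, val_andE, Expr.val]
  rw [foldl_and (fun x => (p x).val)]; simp

theorem val_memE (v : Den n .vertex) (l : Expr (Den n) (.list .vertex)) :
    (memE v l).val = decide ((v : Fin n) ∈ (l.val : List (Fin n))) := by
  simp only [memE, val_orE, Expr.val]
  refine (foldl_or (fun x : Fin n => decide ((v : Fin n).val = x.val)) _ _).trans ?_
  rw [Bool.eq_iff_iff]
  simp [Fin.val_inj]

/-- The pairs of vertices, in the order of two nested loops. -/
def vertexPairs (n : ℕ) : List (Fin n × Fin n) := List.finRange n ×ˢ List.finRange n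

theorem foldl_product {α β σ : Type*} (f : σ → α × β → σ) (l : List α) (l' : List β) (s : σ) :
    l.foldl (fun s x => l'.foldl (fun s y => f s (x, y)) s) s = (l ×ˢ l').foldl f s := by
  induction l generalizing s with
  | nil => rfl
  | cons x l ih =>
    rw [List.foldl_cons, ih, List.product_cons, List.foldl_append, List.foldl_map]

theorem val_edgeE (M : Den n .matrix) (u v : Den n .vertex) :
    (edgeE M u v).val = (decide ((u : Fin n) < v) && M u v) := by
  simp only [edgeE, val_andE, Expr.val]; rfl

theorem val_numEdgesE (M : Den n .matrix) :
    (numEdgesE M).val = (vertexPairs n).countP fun e => decide (e.1 < e.2) && M e.1 e.2 := by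
  simp only [numEdgesE, Expr.val, val_edgeE]
  rw [foldl_product (fun (k : ℕ) (e : Fin n × Fin n) =>
    bif (decide (e.1 < e.2) && M e.1 e.2) then k + 1 else k), foldl_count]
  simp [vertexPairs]

theorem val_singleEdgesE (M : Den n .matrix)
    (acc : Expr (Den n) (.list (.prod (.list .vertex) (.list .vertex)))) :
    (singleEdgesE M acc).val =
      (((vertexPairs n).filter fun e => decide (e.1 < e.2) && M e.1 e.2).map
        fun e => ([e.1], [e.2])).reverse ++ acc.val := by
  simp only [singleEdgesE, Expr.val, val_edgeE]
  rw [foldl_product (fun (k : List (List (Fin n) × List (Fin n))) (e : Fin n × Fin n) =>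
    bif (decide (e.1 < e.2) && M e.1 e.2) then ([e.1], [e.2]) :: k else k)]
  rw [foldl_cons_if (fun e : Fin n × Fin n => decide (e.1 < e.2) && M e.1 e.2)
    (fun e => ([e.1], [e.2]))]
  rfl

theorem val_degreeE (M : Den n .matrix) (v : Den n .vertex) :
    (degreeE M v).val = (List.finRange n).countP (M v) := by
  simp only [degreeE, val_countE, Expr.val]

theorem val_rankE (M : Den n .matrix) (v : Den n .vertex) :
    (rankE M v).val = (List.finRange n).countP fun u =>
      decide ((degreeE M v).val < (degreeE M u).val) ||
        (decide ((degreeE M u).val = (degreeE M v).val) && decide ((u : Fin n) < v)) := by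
  simp only [rankE, val_countE, val_andE, val_orE, Expr.val]; rfl

theorem val_topDegreeE (M : Den n .matrix) (k : Den n .nat) :
    (topDegreeE M k).val = (List.finRange n).filter fun v => decide ((rankE M v).val < k) := by
  simp only [topDegreeE, val_filterE, Expr.val]
  rfl

/-- The lists obtained from `R` by collecting the subsets of size at most `k`. -/
def collectSubsets {α : Type*} (k : ℕ) (R : List α) : List (List α) :=
  R.foldl (fun acc x => ((acc.filter fun S => decide (S.length < k)).map (x :: ·)).reverse ++ acc)
    [[]]

theorem val_subsetsE (k : Den n .nat) (R : Den n (.list .vertex)) :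
    (subsetsE k R).val = (collectSubsets k R).filter fun S => decide (S.length = k) := by
  simp only [subsetsE, val_filterE, Expr.val, val_lengthE, collectSubsets]
  congr 2
  funext acc x
  exact foldl_cons_if (fun S : List (Fin n) => decide (S.length < k)) (x :: ·) acc acc

theorem val_commonE (M : Den n .matrix) (R C : Den n (.list .vertex)) :
    (commonE M R C).val = (List.finRange n).filter fun w =>
      !decide (w ∈ (R : List (Fin n))) && (C : List (Fin n)).all fun v => M v w := by
  simp only [commonE, val_filterE, val_allE, Expr.val, val_memE]
  congr 1
  funext w
  rw [Bool.eq_iff_iff]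
  by_cases h : (w : Fin n) ∈ (R : List (Fin n)) <;> simp [h]

/-- Here `p` is the test for failure. The empty result doubles as the flag that nothing has been
found yet; once there is an entry, later rounds leave the result alone (`stay`). -/
theorem foldl_findFirst {α β : Type*} (p : α → Bool) (f : α → β) (l : List α) :
    (l.foldl (fun res x =>
        bif decide (res.length = 0) then (bif p x then [] else [f x]) else res) [] = [] ∧
      ∀ x ∈ l, p x) ∨
    ∃ x ∈ l, p x = false ∧ l.foldl (fun res x =>
        bif decide (res.length = 0) then (bif p x then [] else [f x]) else res) [] = [f x] := by
  have stay : ∀ (l : List α) (y : β), l.foldl (fun res x =>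
        bif decide (res.length = 0) then (bif p x then [] else [f x]) else res) [y] = [y] := by
    intro l y
    induction l with
    | nil => rfl
    | cons x l ih => simpa using ih
  induction l with
  | nil => left; simp
  | cons x l ih =>
    cases h : p x
    · right
      refine ⟨x, by simp, h, ?_⟩
      rw [List.foldl_cons]
      simpa [h] using stay l (f x)
    · rw [List.foldl_cons]
      simp only [List.length_nil, decide_true, cond_true, h]
      rcases ih with ⟨h1, h2⟩ | ⟨y, hy, h1, h2⟩
      · left; refine ⟨h1, ?_⟩; simpa [h] using h2
      · right; exact ⟨y, by simp [hy], h1, h2⟩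

theorem val_findBipartite (M : Den n .matrix) (k m : Den n .nat) (R : List (Fin n))
    (hR : R = (topDegreeE M (rParam k m)).val) :
    ((findBipartite M k m).val = [] ∧
      ∀ C ∈ (subsetsE (qParam k m) R).val, (commonE M R C).val.length < qParam k m) ∨
    ∃ C ∈ (subsetsE (qParam k m) R).val, qParam k m ≤ (commonE M R C).val.length ∧
      (findBipartite M k m).val = [(C, (commonE M R C).val.take (qParam k m))] := by
  subst hR
  simp only [findBipartite, Expr.val, val_lengthE, val_takeE]
  have := foldl_findFirst
    (fun C => decide ((commonE M (topDegreeE M (rParam k m)).val C).val.length < qParam k m))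
    (fun C : List (Fin n) =>
      (C, (commonE M (topDegreeE M (rParam k m)).val C).val.take (qParam k m)))
    (subsetsE (qParam k m) (topDegreeE M (rParam k m)).val).val
  simpa only [decide_eq_true_eq, decide_eq_false_iff_not, not_lt] using this

/-- The matrix after deleting the edge `e` in both orientations. -/
def deletePair (M : Fin n → Fin n → Bool) (e : Fin n × Fin n) : Fin n → Fin n → Bool :=
  fun i j => if i = e.2 ∧ j = e.1 then false else if i = e.1 ∧ j = e.2 then false else M i j

theorem val_deleteE (M : Expr (Den n) .matrix)
    (K : Den n (.prod (.list .vertex) (.list .vertex))) :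
    (deleteE M K).val = ((K.1 : List (Fin n)) ×ˢ (K.2 : List (Fin n))).foldl deletePair M.val := by
  simp only [deleteE, Expr.val]
  rw [← foldl_product]; rfl

/-- The collection of sublists, in the order of `sublistsE`. -/
def collectSublists {α : Type*} (l : List α) : List (List α) :=
  l.foldl (fun acc x => (acc.map (x :: ·)).reverse ++ acc) [[]]

theorem val_sublistsE (l : Expr (Den n) (.list a)) :
    (sublistsE l).val = collectSublists l.val := by
  simp only [sublistsE, Expr.val, collectSublists]
  congr 1
  funext acc x
  simp

theorem val_bicliquesE (M : Den n .matrix) (P : List (List (Fin n)))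
    (hP : P = collectSublists (List.finRange n)) :
    (bicliquesE M).val = ((P ×ˢ P).filter fun K => decide (0 < K.1.length) &&
      (decide (K.1.length = K.2.length) && K.1.all fun a => K.2.all fun b => M a b)).reverse := by
  subst hP
  simp only [bicliquesE, Expr.val, val_andE, val_lengthE, val_allE, val_sublistsE]
  rw [foldl_product (fun (acc : List (List (Fin n) × List (Fin n)))
      (K : List (Fin n) × List (Fin n)) =>
    bif (decide (0 < K.1.length) && (decide (K.1.length = K.2.length) &&
      K.1.all fun a => K.2.all fun b => M a b)) then (K.1, K.2) :: acc else acc)]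
  rw [foldl_cons_if (fun K : List (Fin n) × List (Fin n) => decide (0 < K.1.length) &&
      (decide (K.1.length = K.2.length) && K.1.all fun a => K.2.all fun b => M a b))
    (fun K => (K.1, K.2))]
  simp

/-- One step of the test whether edges can be deleted one after the other. -/
def checkPair (s : (Fin n → Fin n → Bool) × Bool) (e : Fin n × Fin n) :
    (Fin n → Fin n → Bool) × Bool :=
  bif s.1 e.1 e.2 then (deletePair s.1 e, s.2) else (s.1, false)

theorem val_checkE (M : Den n .matrix)
    (L : Den n (.list (.prod (.list .vertex) (.list .vertex))))
    (s : (Fin n → Fin n → Bool) × Bool)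
    (hs : s = (L : List (List (Fin n) × List (Fin n))).foldl
      (fun s K => (K.1 ×ˢ K.2).foldl checkPair s) (M, true)) :
    (checkE M L).val = (s.2 && decide ((numEdgesE s.1).val = 0)) := by
  have : s = (L : List (List (Fin n) × List (Fin n))).foldl
      (fun s K => K.1.foldl (fun s x => K.2.foldl (fun s y => checkPair s (x, y)) s) s)
      (M, true) := by
    simp only [hs, foldl_product]
  subst this
  simp only [checkE, Expr.val, val_andE]
  rfl

/-- The current best list is replaced only by lists that pass the check, so validity can be followed
without looking at the weights. Minimality is not needed for any of the bounds. -/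
theorem val_bruteForce (M : Den n .matrix) :
    (bruteForce M).val = (singleEdgesE M .nil).val ∨
      (bruteForce M).val ∈ collectSublists (bicliquesE M).val ∧
        (checkE M (bruteForce M).val).val = true := by
  have key : ∀ (l : List (List (List (Fin n) × List (Fin n))))
      (best : List (List (Fin n) × List (Fin n))),
      let f := fun (best L : List (List (Fin n) × List (Fin n))) =>
        bif ((checkE M L).val && decide ((weightE (rep := Den n) L).val <
          (weightE (rep := Den n) best).val)) then L else best
      l.foldl f best = best ∨ l.foldl f best ∈ l ∧ (checkE M (l.foldl f best)).val = true := by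
    intro l best f
    induction l generalizing best with
    | nil => left; rfl
    | cons L l ih =>
      rw [List.foldl_cons]
      rcases ih (f best L) with h | h
      · rw [h]
        by_cases hc : ((checkE M L).val && decide ((weightE (rep := Den n) L).val <
          (weightE (rep := Den n) best).val)) = true
        · right
          have : f best L = L := by simp only [f, hc, cond_true]
          rw [this]
          rw [Bool.and_eq_true] at hc
          exact ⟨by simp, hc.1⟩
        · left
          simp only [f, hc, cond_false]
      · right; exact ⟨List.mem_cons_of_mem _ h.1, h.2⟩
  have := key (sublistsE (bicliquesE M)).val (singleEdgesE M .nil).val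
  rw [val_sublistsE] at this
  simpa only [bruteForce, Expr.val, val_andE, val_sublistsE] using this

end Evaluation

/-! ### Analysis of `q`, `r` and the potential function -/

section Parameters

open Real

/-- The only two demands on the size of `n`, besides `n ≥ 4`: the first yields `q ≥ 1`, the second
`2r² ≤ n`. -/
theorem eventually_log_bounds : ∃ N : ℕ, 4 ≤ N ∧ ∀ n : ℕ, N ≤ n →
    2 * exp 1 * log n ≤ (n : ℝ) / 2 ∧ 2 * (log n) ^ 4 ≤ (n : ℝ) := by
  have h1 : ∀ᶠ x : ℝ in Filter.atTop, log x ≤ (1 / (4 * exp 1)) * x := by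
    have := isLittleO_log_id_atTop.bound (show (0 : ℝ) < 1 / (4 * exp 1) by positivity)
    filter_upwards [this, Filter.eventually_ge_atTop 1] with x hx hx1
    simp only [id, Real.norm_eq_abs] at hx
    rw [abs_of_nonneg (log_nonneg hx1), abs_of_nonneg (by linarith)] at hx
    exact hx
  have h2 : ∀ᶠ x : ℝ in Filter.atTop, (log x) ^ 4 ≤ (1 / 2) * x := by
    have := (isLittleO_pow_log_id_atTop (n := 4)).bound (show (0 : ℝ) < 1 / 2 by positivity)
    filter_upwards [this, Filter.eventually_ge_atTop 1] with x hx hx1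
    simp only [id, Real.norm_eq_abs] at hx
    rw [abs_of_nonneg (pow_nonneg (log_nonneg hx1) 4), abs_of_nonneg (by linarith)] at hx
    exact hx
  obtain ⟨N, hN⟩ := Filter.eventually_atTop.1
    (tendsto_natCast_atTop_atTop.eventually (h1.and h2))
  refine ⟨max N 4, le_max_right _ _, fun n hn => ?_⟩
  obtain ⟨h1, h2⟩ := hN n (le_trans (le_max_left _ _) hn)
  constructor
  · have he := exp_pos 1
    calc 2 * exp 1 * log n ≤ 2 * exp 1 * ((1 / (4 * exp 1)) * n) := by gcongr
      _ = n / 2 := by field_simp; ring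
  · linarith

/-- The properties of the parameters of FIND-BIPARTITE that its analysis uses. -/
structure GoodParams (n m q r : ℕ) : Prop where
  q_pos : 1 ≤ q
  q_le : q ≤ n
  m_pos : 0 < m
  m_le : 2 * m ≤ n ^ 2
  pow_le : (2 * exp 1 * (n : ℝ) ^ 2 / m) ^ q ≤ n / 2
  r_mul_le : r * m ≤ q * n ^ 2
  lt_r_mul : q * n ^ 2 < (r + 1) * m
  r_sq : 2 * r ^ 2 ≤ n
  q_large : log ((n : ℝ) / 2) ≤ 2 * (q * log (2 * exp 1 * (n : ℝ) ^ 2 / m))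

/-- Density means `n²/m ≤ log n`. Hence `A = 2en²/m` lies between `e` and `2e log n ≤ n/2`, so that
`1 ≤ q ≤ log n` and `r ≤ q n²/m ≤ (log n)²`. As the quotient that defines `q` is at least 1,
rounding it down loses at most a factor 2, which is `q_large`. -/
theorem goodParams_of_isDense {n m : ℕ} (hn : 4 ≤ n) (h1 : 2 * exp 1 * log n ≤ (n : ℝ) / 2)
    (h2 : 2 * (log n) ^ 4 ≤ (n : ℝ)) (hm : 2 * m ≤ n ^ 2) (hd : isDense n m = true) :
    GoodParams n m (qParam n m) (rParam n m) := by
  have hd' : (n : ℝ) ^ 2 / log n < m := by simpa [isDense] using hd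
  have hn4 : (4 : ℝ) ≤ n := by exact_mod_cast hn
  have hn0 : (0 : ℝ) < n := by linarith
  have hlog1 : 1 < log n := by
    rw [lt_log_iff_exp_lt hn0]
    linarith [exp_one_lt_d9]
  have hlog0 : 0 < log n := by linarith
  have hmR : (0 : ℝ) < m := lt_of_le_of_lt (by positivity) hd'
  have hm2 : (2 : ℝ) * m ≤ n ^ 2 := by exact_mod_cast hm
  have hml : (n : ℝ) ^ 2 / m ≤ log n := by
    rw [div_lt_iff₀ hlog0] at hd'
    rw [div_le_iff₀ hmR]; linarith
  have hnm : 2 ≤ (n : ℝ) ^ 2 / m := by rw [le_div_iff₀ hmR]; linarith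
  set A : ℝ := 2 * exp 1 * (n : ℝ) ^ 2 / m with hA
  have hAe : A = 2 * exp 1 * ((n : ℝ) ^ 2 / m) := by rw [hA]; ring
  have he := exp_pos 1
  have hA1 : exp 1 ≤ A := by rw [hAe]; nlinarith
  have hA0 : 0 < A := by linarith
  have hlogA : 1 ≤ log A := by rwa [le_log_iff_exp_le hA0]
  have hAn : A ≤ n / 2 := by
    refine le_trans ?_ h1
    rw [hAe]; gcongr
  have hlogAn : log A ≤ log (n / 2) := log_le_log hA0 hAn
  have hx1 : 1 ≤ log ((n : ℝ) / 2) / log A := by rw [le_div_iff₀ (by linarith)]; linarith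
  have hq : qParam n m = ⌊log ((n : ℝ) / 2) / log A⌋₊ := rfl
  have hqle : (qParam n m : ℝ) ≤ log ((n : ℝ) / 2) / log A := by
    rw [hq]; exact Nat.floor_le (by linarith)
  have hqgt : log ((n : ℝ) / 2) / log A < qParam n m + 1 := by
    rw [hq]; exact Nat.lt_floor_add_one _
  have hq1 : 1 ≤ qParam n m := by
    rw [hq]; exact Nat.le_floor (by simpa using hx1)
  have hq1R : (1 : ℝ) ≤ qParam n m := by exact_mod_cast hq1
  have hqA : (qParam n m : ℝ) * log A ≤ log (n / 2) := by
    rwa [le_div_iff₀ (by linarith)] at hqle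
  have hqlog : (qParam n m : ℝ) ≤ log n := by
    have : log ((n : ℝ) / 2) ≤ log n := log_le_log (by linarith) (by linarith)
    nlinarith
  have hrle : (rParam n m : ℝ) ≤ (qParam n m : ℝ) * (n : ℝ) ^ 2 / m :=
    Nat.floor_le (by positivity)
  have hrgt : (qParam n m : ℝ) * (n : ℝ) ^ 2 / m < rParam n m + 1 := Nat.lt_floor_add_one _
  refine ⟨hq1, ?_, by exact_mod_cast hmR, hm, ?_, ?_, ?_, ?_, ?_⟩
  · have : (qParam n m : ℝ) ≤ n := by linarith [log_le_sub_one_of_pos hn0]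
    exact_mod_cast this
  · rw [← hA, ← log_le_log_iff (by positivity) (by linarith), log_pow]
    exact hqA
  · rw [le_div_iff₀ hmR] at hrle
    exact_mod_cast hrle
  · rw [div_lt_iff₀ hmR] at hrgt
    exact_mod_cast hrgt
  · have h3 : (rParam n m : ℝ) ≤ log n ^ 2 := by
      rw [mul_div_assoc] at hrle
      calc (rParam n m : ℝ) ≤ _ := hrle
        _ ≤ log n * log n := by gcongr
        _ = _ := by ring
    have h4 : (2 : ℝ) * (rParam n m : ℝ) ^ 2 ≤ n := by
      calc (2 : ℝ) * (rParam n m : ℝ) ^ 2 ≤ 2 * (log n ^ 2) ^ 2 := by gcongr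
        _ = 2 * log n ^ 4 := by ring
        _ ≤ n := h2
    exact_mod_cast h4
  · rw [← hA]
    rw [div_lt_iff₀ (by linarith)] at hqgt
    nlinarith

/-- The factor `2^q` is split off because it later absorbs the factor `q - 1` from the double
counting. -/
theorem GoodParams.exp_pow_le {n m q r : ℕ} (h : GoodParams n m q r) :
    2 ^ q * (exp 1 * (n : ℝ) ^ 2 / m) ^ q ≤ n / 2 := by
  refine le_trans (le_of_eq ?_) h.pow_le
  rw [← mul_pow]; ring

theorem GoodParams.n_pos {n m q r : ℕ} (h : GoodParams n m q r) : 0 < n :=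
  h.q_pos.trans h.q_le

/-- A weight `x = m / n²` per element bounds the number of sets of size at most `q`. -/
theorem GoodParams.count_le {n m q r k : ℕ} (h : GoodParams n m q r) {c : ℝ} (hk : k ≤ r)
    (hc : c * ((m : ℝ) / n ^ 2) ^ q ≤ (1 + (m : ℝ) / n ^ 2) ^ k) : 2 ^ q * c ≤ n / 2 := by
  have hn : (0 : ℝ) < n := by exact_mod_cast h.n_pos
  have hm : (0 : ℝ) < m := by exact_mod_cast h.m_pos
  have hx : 0 < (m : ℝ) / n ^ 2 := by positivity
  have hr : (r : ℝ) * ((m : ℝ) / n ^ 2) ≤ q := by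
    rw [← mul_div_assoc, div_le_iff₀ (by positivity)]
    exact_mod_cast h.r_mul_le
  have h1 : (1 + (m : ℝ) / n ^ 2) ^ k ≤ exp 1 ^ q := by
    calc (1 + (m : ℝ) / n ^ 2) ^ k ≤ (1 + (m : ℝ) / n ^ 2) ^ r :=
          pow_le_pow_right₀ (by linarith) hk
      _ ≤ exp ((m : ℝ) / n ^ 2) ^ r := by
          gcongr; linarith [add_one_le_exp ((m : ℝ) / n ^ 2)]
      _ = exp (r * ((m : ℝ) / n ^ 2)) := by rw [← exp_nat_mul]
      _ ≤ exp q := exp_le_exp.2 hr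
      _ = exp 1 ^ q := by rw [← exp_nat_mul, mul_one]
  have h2 : c ≤ (exp 1 * (n : ℝ) ^ 2 / m) ^ q := by
    have : exp 1 * (n : ℝ) ^ 2 / m = exp 1 / ((m : ℝ) / n ^ 2) := by field_simp
    rw [this, div_pow, le_div_iff₀ (by positivity)]
    exact hc.trans h1
  calc 2 ^ q * c ≤ 2 ^ q * (exp 1 * (n : ℝ) ^ 2 / m) ^ q := by gcongr
    _ ≤ _ := h.exp_pow_le

/-- The binomial coefficient is the weight of one single term in the expansion of `(1+x)^r`, where
`x = m/n²`. -/
theorem GoodParams.choose_le {n m q r : ℕ} (h : GoodParams n m q r) :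
    2 ^ q * (r.choose q : ℝ) ≤ n / 2 := by
  refine h.count_le (le_refl r) ?_
  rw [add_comm, add_pow]
  by_cases hq : q ≤ r
  · have := Finset.single_le_sum (f := fun i => ((m : ℝ) / n ^ 2) ^ i * 1 ^ (r - i) * (r.choose i))
      (fun i _ => by positivity) (Finset.mem_range.2 (Nat.lt_succ_of_le hq))
    refine le_trans (le_of_eq ?_) this
    simp; ring
  · rw [Nat.choose_eq_zero_of_lt (by omega)]
    simp only [Nat.cast_zero, zero_mul]
    positivity

/-- An antiderivative of `log (A / t)`, which pays for the subgraphs found. -/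
noncomputable def potential (A t : ℝ) : ℝ := t * (log (A / t) + 1)

/-- The derivative `log (A / t)` decreases in `t`, so on the interval from `t` to `m` it is smallest
at `m`. The proof replaces the integral by `log (m/t) ≤ m/t - 1`. -/
theorem potential_sub_ge {A t m : ℝ} (hA : 0 < A) (ht : 0 ≤ t) (htm : t ≤ m) (hm : 0 < m) :
    (m - t) * log (A / m) ≤ potential A m - potential A t := by
  unfold potential
  rcases ht.eq_or_lt with rfl | ht
  · simp; nlinarith
  · rw [log_div hA.ne' hm.ne', log_div hA.ne' ht.ne']
    have h := log_le_sub_one_of_pos (div_pos hm ht)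
    rw [log_div hm.ne' ht.ne'] at h
    have h' : t * (log m - log t) ≤ m - t := by
      calc _ ≤ t * (m / t - 1) := by gcongr
        _ = m - t := by field_simp
    nlinarith

theorem potential_nonneg {A t : ℝ} (hA : t ≤ A) (ht : 0 ≤ t) : 0 ≤ potential A t := by
  unfold potential
  rcases ht.eq_or_lt with rfl | ht
  · simp
  · have : 0 ≤ log (A / t) := log_nonneg (by rwa [le_div_iff₀ ht, one_mul])
    positivity

theorem potential_le {A t : ℝ} (hA : 0 < A) (ht : 0 ≤ t) : potential A t ≤ A := by
  unfold potential
  rcases ht.eq_or_lt with rfl | ht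
  · simpa using hA.le
  · have h := log_le_sub_one_of_pos (div_pos hA ht)
    calc t * (log (A / t) + 1) ≤ t * (A / t) := by gcongr; linarith
      _ = A := by field_simp

/-- Guarantees that the main loop has finished once all edges are gone. For `n = 1` the quotient is
`1 / 0 = 0`, and the strict test still fails. -/
theorem isDense_zero {n : ℕ} (hn : 1 ≤ n) : isDense n 0 = false := by
  have : 0 ≤ log (n : ℝ) := log_nonneg (by exact_mod_cast hn)
  simp only [isDense, decide_eq_false_iff_not, not_lt, Nat.cast_zero]
  positivity

end Parameters

/-! ### Selecting the vertices of highest degree -/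

section Rank

variable {n : ℕ}

/-- The number of vertices that precede `v` by decreasing value of `d`, ties being broken by the
order of the vertices. -/
def rank (d : Fin n → ℕ) (v : Fin n) : ℕ :=
  (Finset.univ.filter fun u => d v < d u ∨ (d u = d v ∧ u < v)).card

/-- By transitivity, all predecessors of `u` precede `v`; moreover `u` precedes `v` but not itself.
-/
theorem rank_lt_rank {d : Fin n → ℕ} {u v : Fin n} (h : d v < d u ∨ (d u = d v ∧ u < v)) :
    rank d u < rank d v := by
  refine Finset.card_lt_card (Finset.ssubset_iff_subset_ne.2 ⟨?_, fun he => ?_⟩)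
  · intro w
    simp only [Finset.mem_filter, Finset.mem_univ, true_and]
    omega
  · have : u ∈ Finset.univ.filter fun w => d v < d w ∨ (d w = d v ∧ w < v) := by simpa using h
    rw [← he] at this
    simp at this

theorem rank_injective (d : Fin n → ℕ) : Function.Injective (rank d) := by
  intro u v h
  by_contra hne
  rcases lt_trichotomy (d u) (d v) with hd | hd | hd
  · have := rank_lt_rank (d := d) (u := v) (v := u) (Or.inl hd); omega
  · rcases lt_or_gt_of_ne hne with hl | hl
    · have := rank_lt_rank (d := d) (u := u) (v := v) (Or.inr ⟨hd, hl⟩); omega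
    · have := rank_lt_rank (d := d) (u := v) (v := u) (Or.inr ⟨hd.symm, hl⟩); omega
  · have := rank_lt_rank (d := d) (u := u) (v := v) (Or.inl hd); omega

theorem rank_lt (d : Fin n → ℕ) (v : Fin n) : rank d v < n := by
  have : rank d v < (Finset.univ : Finset (Fin n)).card := by
    refine Finset.card_lt_card (Finset.ssubset_iff_subset_ne.2 ⟨Finset.subset_univ _, fun he => ?_⟩)
    have := Finset.mem_univ v
    rw [← he] at this
    simp at this
  simpa using this

/-- An injection from `Fin n` into `{0, ..., n-1}` is onto, so each rank below `r` is taken exactly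
once. This is what breaking the ties is for. -/
theorem card_rank_lt (d : Fin n → ℕ) {r : ℕ} (hr : r ≤ n) :
    (Finset.univ.filter fun v => rank d v < r).card = r := by
  have himg : Finset.univ.image (rank d) = Finset.range n := by
    refine Finset.eq_of_subset_of_card_le ?_ ?_
    · intro k hk
      obtain ⟨v, -, rfl⟩ := Finset.mem_image.1 hk
      exact Finset.mem_range.2 (rank_lt d v)
    · rw [Finset.card_image_of_injective _ (rank_injective d)]; simp
  rw [← Finset.card_image_of_injective _ (rank_injective d)]
  have : (Finset.univ.filter fun v => rank d v < r).image (rank d) = Finset.range r := by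
    ext k
    simp only [Finset.mem_image, Finset.mem_filter, Finset.mem_univ, true_and, Finset.mem_range]
    constructor
    · rintro ⟨v, hv, rfl⟩; exact hv
    · intro hk
      have : k ∈ Finset.univ.image (rank d) := by rw [himg]; exact Finset.mem_range.2 (by omega)
      obtain ⟨v, -, rfl⟩ := Finset.mem_image.1 this
      exact ⟨v, hk, rfl⟩
  rw [this, Finset.card_range]

theorem le_of_rank {d : Fin n → ℕ} {r : ℕ} {u v : Fin n} (hv : rank d v < r)
    (hu : ¬rank d u < r) : d u ≤ d v := by
  by_contra h
  have := rank_lt_rank (d := d) (u := u) (v := v) (Or.inl (by omega))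
  omega

end Rank

/-! ### A dense graph contains the required bipartite graph -/

section Existence

open Finset

/-- By Pascal's rule, from `d = q - 1` on each increase of `d` by one increases `d.choose q` by at
least one. This linear bound takes the place of a convexity argument. -/
theorem le_choose_add {d q : ℕ} (hq : 1 ≤ q) : d ≤ d.choose q + (q - 1) := by
  obtain ⟨q, rfl⟩ : ∃ k, q = k + 1 := ⟨q - 1, by omega⟩
  induction d with
  | zero => omega
  | succ d ih =>
    by_cases h : q ≤ d
    · have := Nat.choose_pos h
      rw [Nat.choose_succ_succ']; omega
    · omega

/-- The average of `d` over the top set is at least the average over everything: compare all pairs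
of an element of `R` and an element outside, then add the sum over `R` itself. -/
theorem card_mul_sum_le {ι : Type*} [Fintype ι] [DecidableEq ι] (d : ι → ℕ) (R : Finset ι)
    (h : ∀ v ∈ R, ∀ u ∉ R, d u ≤ d v) : R.card * ∑ v, d v ≤ Fintype.card ι * ∑ v ∈ R, d v := by
  have h1 : R.card * ∑ u ∈ Rᶜ, d u ≤ Rᶜ.card * ∑ v ∈ R, d v := by
    calc R.card * ∑ u ∈ Rᶜ, d u = ∑ v ∈ R, ∑ u ∈ Rᶜ, d u := by simp
      _ ≤ ∑ v ∈ R, ∑ u ∈ Rᶜ, d v :=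
        sum_le_sum fun v hv => sum_le_sum fun u hu => h v hv u (mem_compl.1 hu)
      _ = Rᶜ.card * ∑ v ∈ R, d v := by simp [mul_sum]
  rw [← sum_add_sum_compl R d, ← card_add_card_compl R, mul_add, add_mul]
  omega

open Classical in
/-- The vertices outside `R` that are adjacent to all vertices of `C`. -/
noncomputable def commonNbrs {V : Type*} [Fintype V] (H : SimpleGraph V) (R C : Finset V) :
    Finset V :=
  univ.filter fun w => w ∉ R ∧ ∀ v ∈ C, H.Adj v w

open Classical in
-- Both sides count the pairs `(C, w)` in which `w` lies outside `R` and is adjacent to all of `C`.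
theorem sum_card_commonNbrs {V : Type*} [Fintype V] [DecidableEq V] (H : SimpleGraph V) (R : Finset V) (q : ℕ) :
    ∑ C ∈ R.powersetCard q, (commonNbrs H R C).card =
      ∑ w ∈ Rᶜ, (R.filter fun v => H.Adj v w).card.choose q := by
  have h := sum_card_bipartiteAbove_eq_sum_card_bipartiteBelow (s := R.powersetCard q) (t := Rᶜ)
    (fun C w => ∀ v ∈ C, H.Adj v w)
  convert h using 2 with C hC w hw
  · congr 1
    ext w
    simp [commonNbrs, bipartiteAbove]
  · rw [← card_powersetCard]
    congr 1
    ext C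
    simp only [bipartiteBelow, mem_filter, mem_powersetCard, subset_iff]
    grind

open Classical in
-- Each vertex of `R` has at most `|R|` neighbours inside `R`; the remaining edges are counted from
-- their ends outside `R`.
theorem sum_degree_le {V : Type*} [Fintype V] [DecidableEq V] (H : SimpleGraph V) (R : Finset V) :
    ∑ v ∈ R, H.degree v ≤ ∑ w ∈ Rᶜ, (R.filter fun v => H.Adj v w).card + R.card ^ 2 := by
  have h := sum_card_bipartiteAbove_eq_sum_card_bipartiteBelow (s := R) (t := Rᶜ) H.Adj
  simp only [bipartiteBelow] at h
  rw [← h, sq, ← smul_eq_mul, ← sum_const, ← sum_add_distrib]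
  refine sum_le_sum fun v _ => ?_
  rw [← H.card_neighborFinset_eq_degree]
  calc (H.neighborFinset v).card ≤ (bipartiteAbove H.Adj Rᶜ v ∪ R).card := by
        refine card_le_card fun w hw => ?_
        simp only [SimpleGraph.mem_neighborFinset] at hw
        simp only [bipartiteAbove, mem_union, mem_filter, mem_compl, hw, and_true]
        tauto
    _ ≤ _ := card_union_le _ _

open Classical in
theorem exists_biclique {n m q r : ℕ} (H : SimpleGraph (Fin n)) (hm : H.edgeFinset.card = m)
    (hp : GoodParams n m q r) (R : Finset (Fin n)) (hR : R.card = r)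
    (htop : ∀ v ∈ R, ∀ u ∉ R, H.degree u ≤ H.degree v) :
    ∃ C ∈ R.powersetCard q, q ≤ (commonNbrs H R C).card := by
  by_contra! hcon
  have hq := hp.q_pos
  have hn := hp.n_pos
  have h1 : ∑ C ∈ R.powersetCard q, (commonNbrs H R C).card ≤ (q - 1) * r.choose q := by
    calc _ ≤ ∑ C ∈ R.powersetCard q, (q - 1) :=
          sum_le_sum fun C hC => by have := hcon C hC; omega
      _ = _ := by simp [hR, mul_comm]
  rw [sum_card_commonNbrs] at h1
  set S := ∑ w ∈ Rᶜ, (R.filter fun v => H.Adj v w).card with hS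
  have h2 : S ≤ (q - 1) * r.choose q + n * (q - 1) := by
    calc S ≤ ∑ w ∈ Rᶜ, ((R.filter fun v => H.Adj v w).card.choose q + (q - 1)) :=
          sum_le_sum fun w _ => le_choose_add hq
      _ = ∑ w ∈ Rᶜ, (R.filter fun v => H.Adj v w).card.choose q + Rᶜ.card * (q - 1) := by
          rw [sum_add_distrib, sum_const, smul_eq_mul]
      _ ≤ _ := by
          gcongr
          simpa using card_le_univ Rᶜ
  have h3 := card_mul_sum_le (fun v => H.degree v) R htop
  rw [H.sum_degrees_eq_twice_card_edges, hm, hR, Fintype.card_fin] at h3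
  have h4 := sum_degree_le H R
  rw [← hS, hR] at h4
  have h5 : r.choose q * 2 ^ q * 2 ≤ n := by
    have := hp.choose_le
    have : (r.choose q : ℝ) * 2 ^ q * 2 ≤ n := by linarith
    exact_mod_cast this
  have h6 : 2 * ((q - 1) * r.choose q) ≤ n := by
    have : q - 1 ≤ 2 ^ q := (Nat.sub_le _ _).trans Nat.lt_two_pow_self.le
    calc 2 * ((q - 1) * r.choose q) ≤ 2 * (2 ^ q * r.choose q) := by gcongr
      _ = r.choose q * 2 ^ q * 2 := by ring
      _ ≤ n := h5
  have h7 := hp.r_sq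
  have h8 := hp.lt_r_mul
  have h9 := hp.m_le
  have h10 : r * (2 * m) ≤ n * (S + r ^ 2) := h3.trans (Nat.mul_le_mul_left _ h4)
  -- Doubled: `2S ≤ n + 2n(q-1)` and `2r² ≤ n` add up to `2nq`. Writing `q = k + 1` removes the
  -- truncated subtraction.
  have h11 : S + r ^ 2 ≤ n * q := by
    obtain ⟨k, rfl⟩ : ∃ k, q = k + 1 := ⟨q - 1, by omega⟩
    simp only [Nat.add_sub_cancel] at h2 h6
    rw [mul_add, mul_one]; omega
  have h12 : n * (S + r ^ 2) ≤ n ^ 2 * q := by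
    rw [sq n, mul_assoc]; exact Nat.mul_le_mul_left _ h11
  have h13 : n ^ 2 ≤ q * n ^ 2 := Nat.le_mul_of_pos_left _ hq
  rw [add_mul, one_mul] at h8
  rw [mul_comm (n ^ 2)] at h12
  -- The contradiction: `2rm ≤ qn²`, while `2qn² < 2rm + 2m ≤ 2rm + n² ≤ 2rm + qn²`.
  have h14 : r * (2 * m) = 2 * (r * m) := by ring
  omega

end Existence

/-! ### Adjacency matrices and deletion of edges -/

section Matrices

variable {n : ℕ}

theorem countP_eq_card {α : Type*} [Fintype α] [DecidableEq α] {l : List α} (hl : l.Nodup)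
    (hmem : ∀ x, x ∈ l) (p : α → Bool) :
    l.countP p = (Finset.univ.filter fun x => p x = true).card := by
  rw [List.countP_eq_length_filter, ← List.toFinset_card_of_nodup (hl.filter p)]
  congr 1
  ext x
  simp [hmem]

theorem nodup_vertexPairs : (vertexPairs n).Nodup :=
  (List.nodup_finRange n).product (List.nodup_finRange n)

theorem mem_vertexPairs (e : Fin n × Fin n) : e ∈ vertexPairs n := by
  obtain ⟨u, v⟩ := e
  simp [vertexPairs]

open Classical in
theorem val_degreeE_adjacency (H : SimpleGraph (Fin n)) (v : Fin n) :
    (degreeE (adjacency H) v).val = H.degree v := by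
  rw [val_degreeE, countP_eq_card (List.nodup_finRange n) List.mem_finRange,
    ← H.card_neighborFinset_eq_degree]
  congr 1
  ext w
  simp [adjacency]

theorem val_rankE_eq (M : Den n .matrix) (v : Fin n) :
    (rankE M v).val = rank (fun v => (degreeE M v).val) v := by
  rw [val_rankE, countP_eq_card (List.nodup_finRange n) List.mem_finRange, rank]
  congr 1
  ext u
  simp

open Classical in
theorem val_numEdgesE_adjacency (H : SimpleGraph (Fin n)) :
    (numEdgesE (adjacency H)).val = H.edgeFinset.card := by
  rw [val_numEdgesE, countP_eq_card nodup_vertexPairs mem_vertexPairs]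
  refine Finset.card_bij (fun e _ => s(e.1, e.2)) ?_ ?_ ?_
  · rintro ⟨u, v⟩ h
    simp only [adjacency, Finset.mem_filter, Bool.and_eq_true, decide_eq_true_eq] at h
    simpa using h.2.2
  · rintro ⟨u, v⟩ h ⟨u', v'⟩ h' he
    simp only [Finset.mem_filter, Bool.and_eq_true, decide_eq_true_eq] at h h'
    simp only [Sym2.eq_iff] at he
    rcases he with ⟨rfl, rfl⟩ | ⟨rfl, rfl⟩
    · rfl
    · exact absurd h.2.1 (lt_asymm h'.2.1)
  · intro e
    induction e using Sym2.ind with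
    | _ u v =>
      intro h
      have h : H.Adj u v := by simpa using h
      rcases lt_or_gt_of_ne h.ne with hl | hl
      · exact ⟨(u, v), by simp [adjacency, hl, h], rfl⟩
      · exact ⟨(v, u), by simp [adjacency, hl, h.symm], Sym2.eq_swap⟩

theorem two_mul_numEdges_le (H : SimpleGraph (Fin n)) :
    2 * (numEdgesE (adjacency H)).val ≤ n ^ 2 := by
  classical
  rw [val_numEdgesE_adjacency, ← H.sum_degrees_eq_twice_card_edges]
  calc ∑ v, H.degree v ≤ ∑ _v : Fin n, n :=
        Finset.sum_le_sum fun v _ => by simpa using (H.degree_lt_card_verts v).le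
    _ = n ^ 2 := by simp [sq]

theorem deletePair_adjacency (H : SimpleGraph (Fin n)) (e : Fin n × Fin n) :
    deletePair (adjacency H) e = adjacency (H.deleteEdges {s(e.1, e.2)}) := by
  funext i j
  obtain ⟨u, v⟩ := e
  have hiff : (H.deleteEdges {s(u, v)}).Adj i j ↔
      H.Adj i j ∧ ¬((i = u ∧ j = v) ∨ (i = v ∧ j = u)) := by
    rw [SimpleGraph.deleteEdges_adj, Set.mem_singleton_iff, Sym2.eq_iff]
  rw [Bool.eq_iff_iff]
  simp only [deletePair, adjacency, decide_eq_true_eq, hiff]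
  split_ifs <;> simp_all

/-- The set of edges listed in `P`. -/
def listedEdges {V : Type*} (P : List (V × V)) : Set (Sym2 V) := {e | ∃ p ∈ P, e = s(p.1, p.2)}

theorem listedEdges_cons {V : Type*} (p : V × V) (P : List (V × V)) :
    listedEdges (p :: P) = {s(p.1, p.2)} ∪ listedEdges P := by
  ext e; simp [listedEdges]

theorem foldl_deletePair (P : List (Fin n × Fin n)) (H : SimpleGraph (Fin n)) :
    P.foldl deletePair (adjacency H) = adjacency (H.deleteEdges (listedEdges P)) := by
  induction P generalizing H with
  | nil => simp [listedEdges]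
  | cons p P ih =>
    rw [List.foldl_cons, deletePair_adjacency, ih, SimpleGraph.deleteEdges_deleteEdges,
      listedEdges_cons]

theorem foldl_checkPair_false (P : List (Fin n × Fin n)) (M : Fin n → Fin n → Bool) :
    (P.foldl checkPair (M, false)).2 = false := by
  induction P generalizing M with
  | nil => rfl
  | cons p P ih =>
    rw [List.foldl_cons]
    cases h : M p.1 p.2 <;> simp [checkPair, h, ih]

/-- A failed test is never forgiven (`foldl_checkPair_false`), so final success means that every
pair was an edge at the moment of its deletion. -/
theorem foldl_checkPair (P : List (Fin n × Fin n)) (H : SimpleGraph (Fin n))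
    (h : (P.foldl checkPair (adjacency H, true)).2 = true) :
    listedEdges P ⊆ H.edgeSet ∧
      P.foldl checkPair (adjacency H, true) =
        (adjacency (H.deleteEdges (listedEdges P)), true) := by
  induction P generalizing H with
  | nil => simp [listedEdges]
  | cons p P ih =>
    rw [List.foldl_cons] at h ⊢
    by_cases hp : H.Adj p.1 p.2
    · have hs : checkPair (adjacency H, true) p =
          (adjacency (H.deleteEdges {s(p.1, p.2)}), true) := by
        simp only [checkPair, ← deletePair_adjacency]
        simp [adjacency, hp]
      rw [hs] at h ⊢
      obtain ⟨h1, h2⟩ := ih _ h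
      rw [h2, SimpleGraph.deleteEdges_deleteEdges, listedEdges_cons]
      refine ⟨?_, rfl⟩
      rw [SimpleGraph.edgeSet_deleteEdges] at h1
      rintro e (he | he)
      · rw [Set.mem_singleton_iff.1 he]; exact hp
      · exact (h1 he).1
    · have hs : checkPair (adjacency H, true) p = (adjacency H, false) := by
        simp [checkPair, adjacency, hp]
      rw [hs, foldl_checkPair_false] at h
      exact absurd h (by simp)

/-- The vertex sets of a bipartite graph that is given by lists. -/
def toFinsets (K : List (Fin n) × List (Fin n)) : Finset (Fin n) × Finset (Fin n) :=
  (K.1.toFinset, K.2.toFinset)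

theorem listedEdges_product (K : List (Fin n) × List (Fin n)) :
    listedEdges (K.1 ×ˢ K.2) = edges (toFinsets K) := by
  ext e
  simp only [listedEdges, edges, toFinsets, Set.mem_ofPred_eq, List.mem_toFinset]
  constructor
  · rintro ⟨p, hp, rfl⟩
    have hp := List.pair_mem_product.1 (show (p.1, p.2) ∈ K.1 ×ˢ K.2 from hp)
    exact ⟨p.1, hp.1, p.2, hp.2, rfl⟩
  · rintro ⟨a, ha, b, hb, rfl⟩
    exact ⟨(a, b), List.pair_mem_product.2 ⟨ha, hb⟩, rfl⟩

end Matrices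

/-! ### Partial decompositions -/

section Decompositions

variable {V : Type*}

/-- The bipartite graphs in `L` decompose the edges of `G` outside `H`. -/
structure IsPartialDecomposition (G H : SimpleGraph V) (L : List (Finset V × Finset V)) :
    Prop where
  nonempty : ∀ K ∈ L, K.1.Nonempty
  disjoint_parts : ∀ K ∈ L, Disjoint K.1 K.2
  balanced : ∀ K ∈ L, K.1.card = K.2.card
  edge_disjoint : L.Pairwise fun K K' => Disjoint (edges K) (edges K')
  disjoint_rest : ∀ K ∈ L, Disjoint (edges K) H.edgeSet
  cover : ∀ e : Sym2 V, e ∈ G.edgeSet ↔ e ∈ H.edgeSet ∨ ∃ K ∈ L, e ∈ edges K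

theorem isPartialDecomposition_nil (G : SimpleGraph V) : IsPartialDecomposition G G [] := by
  constructor <;> simp

theorem IsPartialDecomposition.isBalancedDecomposition {G H : SimpleGraph V}
    {L : List (Finset V × Finset V)} (h : IsPartialDecomposition G H L) (hH : H = ⊥) :
    IsBalancedDecomposition G L := by
  subst hH
  exact ⟨h.nonempty, h.disjoint_parts, h.balanced, h.edge_disjoint, fun e => by simp [h.cover e]⟩

/-- The new member takes its edges from the rest `H`, which is disjoint from all earlier members.
Its parts are disjoint for free, since a common vertex would be a loop of `H`. -/
theorem IsPartialDecomposition.cons {G H : SimpleGraph V} {L : List (Finset V × Finset V)}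
    (h : IsPartialDecomposition G H L) {K : Finset V × Finset V} (h1 : K.1.Nonempty)
    (h2 : K.1.card = K.2.card) (h3 : edges K ⊆ H.edgeSet) :
    IsPartialDecomposition G (H.deleteEdges (edges K)) (K :: L) where
  nonempty := by simpa [h1] using h.nonempty
  disjoint_parts := by
    have : Disjoint K.1 K.2 := by
      rw [Finset.disjoint_left]
      intro a ha hb
      have : s(a, a) ∈ H.edgeSet := h3 ⟨a, ha, a, hb, rfl⟩
      exact H.irrefl this
    simpa [this] using h.disjoint_parts
  balanced := by simpa [h2] using h.balanced
  edge_disjoint := by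
    rw [List.pairwise_cons]
    exact ⟨fun K' hK' => (h.disjoint_rest K' hK').symm.mono_left h3, h.edge_disjoint⟩
  disjoint_rest := by
    rw [SimpleGraph.edgeSet_deleteEdges]
    intro K' hK'
    rcases List.mem_cons.1 hK' with rfl | hK'
    · exact Set.disjoint_sdiff_right
    · exact (h.disjoint_rest K' hK').mono_right Set.sdiff_subset
  cover := by
    intro e
    rw [h.cover e, SimpleGraph.edgeSet_deleteEdges]
    simp only [Set.mem_sdiff, List.mem_cons, exists_eq_or_imp]
    have := @h3 e
    tauto

theorem IsPartialDecomposition.append_singles {n : ℕ} {G H : SimpleGraph (Fin n)}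
    {L : List (Finset (Fin n) × Finset (Fin n))} (h : IsPartialDecomposition G H L)
    (P : List (Fin n × Fin n)) (hP : P.Nodup) (hlt : ∀ p ∈ P, p.1 < p.2)
    (hadj : ∀ p ∈ P, H.Adj p.1 p.2) :
    IsPartialDecomposition G (H.deleteEdges (listedEdges P))
      ((P.map fun p => (({p.1} : Finset (Fin n)), ({p.2} : Finset (Fin n)))).reverse ++ L) := by
  induction P generalizing H L with
  | nil => simpa [listedEdges] using h
  | cons p P ih =>
    have hedges : edges (({p.1} : Finset (Fin n)), ({p.2} : Finset (Fin n))) =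
        {s(p.1, p.2)} := by
      ext e; simp [edges]
    have h' := h.cons (K := ({p.1}, {p.2})) (by simp) (by simp) (by
      rw [hedges, Set.singleton_subset_iff]
      exact hadj p (by simp))
    rw [hedges] at h'
    rw [List.nodup_cons] at hP
    -- Since pairs are listed in increasing orientation only, distinct pairs are distinct edges;
    -- deleting the first leaves the others in the graph.
    have := ih h' hP.2 (fun p' hp' => hlt p' (by simp [hp'])) (fun p' hp' => by
      rw [SimpleGraph.deleteEdges_adj]
      refine ⟨hadj p' (by simp [hp']), fun he => ?_⟩
      rw [Set.mem_singleton_iff, Sym2.eq_iff] at he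
      have hl := hlt p (by simp)
      have hl' := hlt p' (by simp [hp'])
      rcases he with ⟨e1, e2⟩ | ⟨e1, e2⟩
      · exact hP.1 (by rwa [← Prod.ext e1 e2])
      · rw [e1, e2] at hl'
        exact absurd hl (lt_asymm hl'))
    rw [SimpleGraph.deleteEdges_deleteEdges, ← listedEdges_cons] at this
    simpa using this

theorem complexity_append (L L' : List (Finset V × Finset V)) :
    complexity (L ++ L') = complexity L + complexity L' := by
  simp [complexity]

end Decompositions

/-! ### Correctness of the final splitting and of brute force -/

section Correctness

variable {n : ℕ}

/-- The rest of the graph is split into single edges. -/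
theorem singleEdges_spec {G H : SimpleGraph (Fin n)} {L : List (List (Fin n) × List (Fin n))}
    (h : IsPartialDecomposition G H (L.map toFinsets))
    (acc : Expr (Den n) (.list (.prod (.list .vertex) (.list .vertex)))) (hacc : acc.val = L) :
    IsBalancedDecomposition G ((singleEdgesE (adjacency H) acc).val.map toFinsets) ∧
      complexity ((singleEdgesE (adjacency H) acc).val.map toFinsets) =
        2 * (numEdgesE (adjacency H)).val + complexity (L.map toFinsets) := by
  subst hacc
  set P := (vertexPairs n).filter fun e => decide (e.1 < e.2) && adjacency H e.1 e.2 with hPdef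
  have hP : ∀ p, p ∈ P ↔ p.1 < p.2 ∧ H.Adj p.1 p.2 := by
    intro p
    simp [P, mem_vertexPairs, adjacency]
  have hval : (singleEdgesE (adjacency H) acc).val.map toFinsets =
      (P.map fun p => (({p.1} : Finset (Fin n)), ({p.2} : Finset (Fin n)))).reverse ++
        acc.val.map toFinsets := by
    rw [val_singleEdgesE, List.map_append, List.map_reverse, List.map_map]
    congr 3
  rw [hval]
  constructor
  · refine (h.append_singles P (nodup_vertexPairs.filter _) (fun p hp => ((hP p).1 hp).1)
      fun p hp => ((hP p).1 hp).2).isBalancedDecomposition ?_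
    ext u v
    simp only [SimpleGraph.deleteEdges_adj, SimpleGraph.bot_adj, iff_false, not_and, not_not]
    intro huv
    rcases lt_or_gt_of_ne huv.ne with hl | hl
    · exact ⟨(u, v), (hP _).2 ⟨hl, huv⟩, rfl⟩
    · exact ⟨(v, u), (hP _).2 ⟨hl, huv.symm⟩, Sym2.eq_swap⟩
  · rw [complexity_append]
    congr 1
    rw [val_numEdgesE, List.countP_eq_length_filter, ← hPdef]
    simp [complexity, Function.comp_def, mul_comm]

/-- Entries are prepended as the list is traversed, hence the reversal. The induction keeps track of
the part `l₀` already traversed. -/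
theorem mem_collectSublists {α : Type*} {l S : List α} (hS : S ∈ collectSublists l) :
    S.reverse.Sublist l := by
  suffices h : ∀ (l l₀ : List α) (acc : List (List α)), (∀ S ∈ acc, S.reverse.Sublist l₀) →
      ∀ S ∈ l.foldl (fun acc x => (acc.map (x :: ·)).reverse ++ acc) acc,
        S.reverse.Sublist (l₀ ++ l) by
    simpa using h l [] [[]] (by simp) S hS
  intro l
  induction l with
  | nil => simp
  | cons x l ih =>
    intro l₀ acc hacc S hS
    rw [List.foldl_cons] at hS
    have := ih (l₀ ++ [x]) _ (fun S hS => by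
      rcases List.mem_append.1 hS with hS | hS
      · rw [List.mem_reverse, List.mem_map] at hS
        obtain ⟨T, hT, rfl⟩ := hS
        rw [List.reverse_cons]
        exact (hacc T hT).append (List.Sublist.refl _)
      · exact (hacc S hS).trans (List.sublist_append_left _ _)) S hS
    simpa using this

/-- A balanced complete bipartite graph that is given by lists. -/
structure IsBalancedPair (K : List (Fin n) × List (Fin n)) : Prop where
  nodup_fst : K.1.Nodup
  nodup_snd : K.2.Nodup
  length_eq : K.1.length = K.2.length
  length_pos : 0 < K.1.length

theorem IsBalancedPair.card_fst {K : List (Fin n) × List (Fin n)} (h : IsBalancedPair K) :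
    (toFinsets K).1.card = K.1.length := List.toFinset_card_of_nodup h.nodup_fst

theorem IsBalancedPair.card_snd {K : List (Fin n) × List (Fin n)} (h : IsBalancedPair K) :
    (toFinsets K).2.card = K.1.length :=
  (List.toFinset_card_of_nodup h.nodup_snd).trans h.length_eq.symm

theorem IsBalancedPair.cons {G H : SimpleGraph (Fin n)} {L : List (List (Fin n) × List (Fin n))}
    {K : List (Fin n) × List (Fin n)} (hK : IsBalancedPair K)
    (h : IsPartialDecomposition G H (L.map toFinsets)) (hsub : edges (toFinsets K) ⊆ H.edgeSet) :
    IsPartialDecomposition G (H.deleteEdges (edges (toFinsets K))) ((K :: L).map toFinsets) := by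
  refine h.cons ?_ ?_ hsub
  · rw [← Finset.card_pos, hK.card_fst]; exact hK.length_pos
  · rw [hK.card_fst, hK.card_snd]

theorem isBalancedPair_of_mem_bicliquesE {M : Den n .matrix} {K : List (Fin n) × List (Fin n)}
    (hK : K ∈ (bicliquesE M).val) : IsBalancedPair K := by
  rw [val_bicliquesE M _ rfl, List.mem_reverse, List.mem_filter] at hK
  obtain ⟨h1, h2⟩ := hK
  have h1 := List.pair_mem_product.1 (show (K.1, K.2) ∈ _ from h1)
  simp only [Bool.and_eq_true, decide_eq_true_eq] at h2
  have hnd : ∀ S ∈ collectSublists (List.finRange n), S.Nodup := fun S hS =>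
    List.nodup_reverse.1 ((mem_collectSublists hS).nodup (List.nodup_finRange n))
  exact ⟨hnd _ h1.1, hnd _ h1.2, h2.2.1, h2.1⟩

theorem foldl_check_false (L : List (List (Fin n) × List (Fin n))) (M : Fin n → Fin n → Bool) :
    (L.foldl (fun s K => (K.1 ×ˢ K.2).foldl checkPair s) (M, false)).2 = false := by
  induction L generalizing M with
  | nil => rfl
  | cons K L ih =>
    rw [List.foldl_cons]
    have h := foldl_checkPair_false (K.1 ×ˢ K.2) M
    rw [← Prod.mk.eta (p := List.foldl checkPair (M, false) (K.1 ×ˢ K.2)), h]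
    exact ih _

/-- The matrix that remains after each accepted member represents the rest of a partial
decomposition. Members are stacked on `L₀`, so they come out in reverse order. -/
theorem foldl_check {G : SimpleGraph (Fin n)} (L : List (List (Fin n) × List (Fin n)))
    (hL : ∀ K ∈ L, IsBalancedPair K) (H : SimpleGraph (Fin n))
    (L₀ : List (List (Fin n) × List (Fin n)))
    (h : IsPartialDecomposition G H (L₀.map toFinsets))
    (ht : (L.foldl (fun s K => (K.1 ×ˢ K.2).foldl checkPair s) (adjacency H, true)).2 = true) :
    ∃ H', (L.foldl (fun s K => (K.1 ×ˢ K.2).foldl checkPair s) (adjacency H, true)).1 =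
        adjacency H' ∧ IsPartialDecomposition G H' ((L.reverse ++ L₀).map toFinsets) := by
  induction L generalizing H L₀ with
  | nil => exact ⟨H, rfl, h⟩
  | cons K L ih =>
    rw [List.foldl_cons] at ht ⊢
    have hK : (List.foldl checkPair (adjacency H, true) (K.1 ×ˢ K.2)).2 = true := by
      by_contra hf
      rw [← Prod.mk.eta (p := List.foldl checkPair (adjacency H, true) (K.1 ×ˢ K.2)),
        Bool.eq_false_of_not_eq_true hf, foldl_check_false] at ht
      exact absurd ht (by simp)
    obtain ⟨h1, h2⟩ := foldl_checkPair _ _ hK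
    rw [listedEdges_product] at h1 h2
    rw [h2] at ht ⊢
    have := ih (fun K hK => hL K (by simp [hK])) _ (K :: L₀)
      ((hL K (by simp)).cons h h1) ht
    simpa using this

theorem eq_bot_of_numEdges {H : SimpleGraph (Fin n)} (h : (numEdgesE (adjacency H)).val = 0) :
    H = ⊥ := by
  classical
  rw [val_numEdgesE_adjacency, Finset.card_eq_zero] at h
  rw [← SimpleGraph.edgeFinset_eq_empty]
  exact h

theorem bruteForce_spec (G : SimpleGraph (Fin n)) :
    IsBalancedDecomposition G ((bruteForce (adjacency G)).val.map toFinsets) := by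
  rcases val_bruteForce (adjacency G) with h | ⟨h1, h2⟩
  · rw [h]
    exact (singleEdges_spec (L := []) (isPartialDecomposition_nil G) .nil rfl).1
  · set L := (bruteForce (adjacency G)).val
    have hL : ∀ K ∈ L, IsBalancedPair K := fun K hK =>
      isBalancedPair_of_mem_bicliquesE
        ((mem_collectSublists h1).subset (List.mem_reverse.2 hK))
    rw [val_checkE _ _ _ rfl, Bool.and_eq_true, decide_eq_true_eq] at h2
    obtain ⟨H, hH, hd⟩ := foldl_check L hL G [] (isPartialDecomposition_nil G) h2.1
    rw [hH] at h2
    have := hd.isBalancedDecomposition (eq_bot_of_numEdges h2.2)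
    simp only [List.append_nil, List.map_reverse] at this
    refine ⟨fun K hK => this.nonempty K (by simpa using hK),
      fun K hK => this.disjoint_parts K (by simpa using hK),
      fun K hK => this.balanced K (by simpa using hK), ?_, fun e => by simpa using this.cover e⟩
    -- The decomposition was built backwards, which is harmless because disjointness is symmetric.
    have hp := List.pairwise_reverse.1 this.edge_disjoint
    exact hp.imp fun h => h.symm

end Correctness

/-! ### Enumerating the small subsets of `R`, and how many there are -/

section Subsets

variable {α : Type*} {k : ℕ}

theorem collectSubsets_concat (R : List α) (x : α) :
    collectSubsets k (R ++ [x]) =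
      (((collectSubsets k R).filter fun S => decide (S.length < k)).map (x :: ·)).reverse ++
        collectSubsets k R := by
  simp [collectSubsets]

/-- Discarding lists longer than `k` loses nothing, as each list is built up through shorter ones.
The implication from right to left makes the search in FIND-BIPARTITE exhaustive. -/
theorem mem_collectSubsets {R S : List α} :
    S ∈ collectSubsets k R ↔ S.reverse.Sublist R ∧ S.length ≤ k := by
  induction R using List.reverseRecOn generalizing S with
  | nil =>
    simp only [collectSubsets, List.foldl_nil, List.mem_singleton, List.sublist_nil,
      List.reverse_eq_nil_iff]
    constructor
    · rintro rfl; simp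
    · exact fun h => h.1
  | append_singleton R x ih =>
    rw [collectSubsets_concat, List.mem_append, List.mem_reverse, List.mem_map, ih,
      List.sublist_append_iff]
    constructor
    · rintro (⟨T, hT, rfl⟩ | ⟨h1, h2⟩)
      · rw [List.mem_filter, ih, decide_eq_true_eq] at hT
        exact ⟨⟨T.reverse, [x], by simp, hT.1.1, List.Sublist.refl _⟩, by simpa using hT.2⟩
      · exact ⟨⟨S.reverse, [], by simp, h1, by simp⟩, h2⟩
    · rintro ⟨⟨l₁, l₂, h, h1, h2⟩, h3⟩
      rcases List.sublist_singleton.1 h2 with rfl | rfl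
      · right
        rw [List.append_nil] at h
        exact ⟨h ▸ h1, h3⟩
      · left
        have hS : S = x :: l₁.reverse := by
          rw [← List.reverse_reverse S, h]; simp
        subst hS
        refine ⟨l₁.reverse, ?_, rfl⟩
        rw [List.mem_filter, ih, decide_eq_true_eq]
        simp only [List.reverse_reverse, h1, true_and]
        simp only [List.length_cons] at h3
        omega

/-- A new element `y` adds to some of the old lists `S` the list `y :: S`, of weight `x` times that
of `S`, so the total grows at most by the factor `1 + x`. -/
theorem sum_pow_collectSubsets_le (R : List α) {x : ℝ} (hx : 0 ≤ x) :
    ((collectSubsets k R).map fun S => x ^ S.length).sum ≤ (1 + x) ^ R.length := by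
  induction R using List.reverseRecOn with
  | nil => simp [collectSubsets]
  | append_singleton R y ih =>
    have hfilter : ∀ l : List (List α),
        ((l.filter fun S => decide (S.length < k)).map fun S => x ^ S.length * x).sum ≤
          x * (l.map fun S => x ^ S.length).sum := by
      intro l
      induction l with
      | nil => simp
      | cons S l ihl =>
        have hS : 0 ≤ x * x ^ S.length := by positivity
        rw [List.map_cons, List.sum_cons, mul_add, List.filter_cons]
        split_ifs
        · rw [List.map_cons, List.sum_cons, mul_comm (x ^ S.length)]
          gcongr
        · linarith
    rw [collectSubsets_concat, List.map_append, List.sum_append, List.map_reverse,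
      List.sum_reverse, List.map_map]
    have h := hfilter (collectSubsets k R)
    simp only [Function.comp_def, List.length_cons, pow_succ, List.length_append,
      List.length_nil, zero_add]
    nlinarith

/-- With `x = m/n² ≤ 1`, every list of length at most `q` weighs at least `x^q`, so the bound on the
total weight bounds the number of lists. This is what makes the exhaustive search polynomial. -/
theorem length_collectSubsets_le {n m q r : ℕ} (h : GoodParams n m q r) {R : List α}
    (hR : R.length ≤ r) : (collectSubsets q R).length ≤ n := by
  have hn : (0 : ℝ) < n := by exact_mod_cast h.n_pos
  have hm : (0 : ℝ) < m := by exact_mod_cast h.m_pos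
  have hx1 : (m : ℝ) / n ^ 2 ≤ 1 := by
    have : (2 : ℝ) * m ≤ n ^ 2 := by exact_mod_cast h.m_le
    rw [div_le_one (by positivity)]; linarith
  have hx0 : 0 ≤ (m : ℝ) / n ^ 2 := by positivity
  have h1 : ((collectSubsets q R).length : ℝ) * ((m : ℝ) / n ^ 2) ^ q ≤
      (1 + (m : ℝ) / n ^ 2) ^ R.length := by
    refine le_trans ?_ (sum_pow_collectSubsets_le (k := q) R hx0)
    have := List.sum_le_sum (l := collectSubsets q R) (f := fun _ => ((m : ℝ) / n ^ 2) ^ q)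
      (g := fun S => ((m : ℝ) / n ^ 2) ^ S.length) fun S hS =>
        pow_le_pow_of_le_one hx0 hx1 (mem_collectSubsets.1 hS).2
    simpa using this
  have h2 := h.count_le hR h1
  have h3 : (1 : ℝ) ≤ 2 ^ q := one_le_pow₀ (by norm_num)
  have h4 : ((collectSubsets q R).length : ℝ) ≤ n := by
    have : (0 : ℝ) ≤ (collectSubsets q R).length := by positivity
    nlinarith
  exact_mod_cast h4

end Subsets

/-! ### FIND-BIPARTITE succeeds on dense graphs -/

section FindBipartite

variable {n : ℕ}

theorem toFinset_topDegreeE (M : Den n .matrix) (r : ℕ) :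
    ((topDegreeE M r).val : List (Fin n)).toFinset =
      Finset.univ.filter fun v => rank (fun v => (degreeE M v).val) v < r := by
  ext v
  simp [val_topDegreeE, val_rankE_eq]

theorem nodup_topDegreeE (M : Den n .matrix) (r : ℕ) :
    ((topDegreeE M r).val : List (Fin n)).Nodup := by
  rw [val_topDegreeE]; exact (List.nodup_finRange n).filter _

theorem length_topDegreeE (M : Den n .matrix) {r : ℕ} (hr : r ≤ n) :
    ((topDegreeE M r).val : List (Fin n)).length = r := by
  rw [← List.toFinset_card_of_nodup (nodup_topDegreeE M r), toFinset_topDegreeE,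
    card_rank_lt _ hr]

theorem nodup_commonE (M : Den n .matrix) (R C : List (Fin n)) :
    ((commonE M R C).val : List (Fin n)).Nodup := by
  rw [val_commonE]; exact (List.nodup_finRange n).filter _

theorem toFinset_commonE (H : SimpleGraph (Fin n)) (R C : List (Fin n)) :
    ((commonE (adjacency H) R C).val : List (Fin n)).toFinset =
      commonNbrs H R.toFinset C.toFinset := by
  ext w
  simp [val_commonE, commonNbrs, adjacency]

theorem GoodParams.r_le {n m q r : ℕ} (h : GoodParams n m q r) : r ≤ n := by
  have := h.r_sq
  nlinarith

theorem findBipartite_spec (H : SimpleGraph (Fin n)) {m : ℕ}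
    (hm : (numEdgesE (adjacency H)).val = m)
    (hp : GoodParams n m (qParam n m) (rParam n m)) :
    ∃ K : List (Fin n) × List (Fin n), (findBipartite (adjacency H) n m).val = [K] ∧
      IsBalancedPair K ∧ K.1.length = qParam n m ∧ edges (toFinsets K) ⊆ H.edgeSet := by
  classical
  set R : List (Fin n) := (topDegreeE (adjacency H) (rParam n m)).val with hR
  have hRnd : R.Nodup := nodup_topDegreeE _ _
  rcases val_findBipartite (adjacency H) n m R hR with ⟨-, h⟩ | ⟨C, hC, h1, h2⟩
  · exfalso
    have hRF : R.toFinset = Finset.univ.filter fun v => rank (fun v => H.degree v) v < rParam n m := by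
      rw [hR, toFinset_topDegreeE]
      simp only [val_degreeE_adjacency]
    obtain ⟨C, hC, hD⟩ := exists_biclique H (by rw [← hm, val_numEdgesE_adjacency]) hp R.toFinset
      (by rw [hRF, card_rank_lt _ hp.r_le]) (fun v hv u hu => by
        rw [hRF] at hv hu
        exact le_of_rank (by simpa using hv) (by simpa using hu))
    rw [Finset.mem_powersetCard] at hC
    -- The set `C` has to be found among the enumerated lists: it is represented by the reverse of
    -- the sublist of `R` consisting of its elements.
    have hT : (R.filter (· ∈ C)).toFinset = C := by
      ext v
      have := @hC.1 v
      simp only [List.mem_toFinset] at this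
      simp only [List.toFinset_filter, Finset.mem_filter, List.mem_toFinset, decide_eq_true_eq]
      tauto
    have hTlen : (R.filter (· ∈ C)).length = qParam n m := by
      rw [← List.toFinset_card_of_nodup (hRnd.filter _), hT, hC.2]
    have hmem : (R.filter (· ∈ C)).reverse ∈ (subsetsE (rep := Den n) (qParam n m) R).val := by
      rw [val_subsetsE, List.mem_filter, mem_collectSubsets]
      simp only [List.reverse_reverse, List.length_reverse, decide_eq_true_eq]
      exact ⟨⟨List.filter_sublist, hTlen.le⟩, hTlen⟩
    have := h _ hmem
    rw [← List.toFinset_card_of_nodup (nodup_commonE _ _ _), toFinset_commonE,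
      List.toFinset_reverse, hT] at this
    omega
  · rw [val_subsetsE, List.mem_filter, mem_collectSubsets, decide_eq_true_eq] at hC
    refine ⟨_, h2, ⟨?_, ?_, ?_, ?_⟩, hC.2, ?_⟩
    · exact List.nodup_reverse.1 (hC.1.1.nodup hRnd)
    · exact (nodup_commonE _ _ _).sublist (List.take_sublist _ _)
    · simp only [List.length_take]
      rw [hC.2]; omega
    · simp only
      rw [hC.2]; exact hp.q_pos
    · rintro e ⟨a, ha, b, hb, rfl⟩
      simp only [toFinsets, List.mem_toFinset] at ha hb
      have hb := List.mem_of_mem_take hb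
      rw [val_commonE, List.mem_filter] at hb
      simp only [Bool.and_eq_true, List.all_eq_true, adjacency, decide_eq_true_eq] at hb
      exact hb.2.2 a ha

end FindBipartite

/-! ### The main loop and the complexity bound -/

section MainLoop

variable {n : ℕ}

open Real

/-- One round of the main loop of FIND-DECOMPOSITION. -/
noncomputable def mainStep (s : (Fin n → Fin n → Bool) × List (List (Fin n) × List (Fin n))) :
    (Fin n → Fin n → Bool) × List (List (Fin n) × List (Fin n)) :=
  bif isDense n (numEdgesE (rep := Den n) s.1).val then
    (findBipartite (rep := Den n) s.1 n (numEdgesE (rep := Den n) s.1).val).val.foldl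
      (fun s K => ((deleteE (rep := Den n) (.var s.1) K).val, K :: s.2)) s
  else s

/-- Distinct pairs of the product give distinct edges: two pairs that differ by a swap would put a
vertex into both parts, and `H` has no loops. -/
theorem card_edges_toFinsets {K : List (Fin n) × List (Fin n)} (hK : IsBalancedPair K)
    {H : SimpleGraph (Fin n)} (hsub : edges (toFinsets K) ⊆ H.edgeSet) :
    (numEdgesE (adjacency (H.deleteEdges (edges (toFinsets K))))).val + K.1.length ^ 2 =
      (numEdgesE (adjacency H)).val := by
  classical
  have himg : ((toFinsets K).1 ×ˢ (toFinsets K).2).image (fun p => s(p.1, p.2)) ⊆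
      H.edgeFinset := by
    intro e he
    obtain ⟨p, hp, rfl⟩ := Finset.mem_image.1 he
    rw [Finset.mem_product] at hp
    rw [SimpleGraph.mem_edgeFinset]
    exact hsub ⟨p.1, hp.1, p.2, hp.2, rfl⟩
  have hcard : (((toFinsets K).1 ×ˢ (toFinsets K).2).image (fun p => s(p.1, p.2))).card =
      K.1.length ^ 2 := by
    rw [Finset.card_image_of_injOn, Finset.card_product, hK.card_fst, hK.card_snd, sq]
    rintro ⟨u, v⟩ h ⟨u', v'⟩ h' he
    simp only [Finset.coe_product, Set.mem_prod, Finset.mem_coe] at h h'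
    rcases Sym2.eq_iff.1 he with ⟨h1, h2⟩ | ⟨h1, h2⟩
    · exact Prod.ext h1 h2
    · simp only at h1
      subst h1
      exact absurd (hsub ⟨u, h.1, u, h'.2, rfl⟩) (H.irrefl)
  rw [val_numEdgesE_adjacency, val_numEdgesE_adjacency, ← hcard,
    ← Finset.card_sdiff_add_card_eq_card himg]
  congr 2
  ext e
  have hset := H.edgeSet_deleteEdges (edges (toFinsets K))
  generalize H.deleteEdges (edges (toFinsets K)) = H' at hset
  rw [SimpleGraph.mem_edgeFinset, hset, Set.mem_sdiff, Finset.mem_sdiff,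
    SimpleGraph.mem_edgeFinset]
  refine and_congr_right fun _ => not_congr ?_
  simp only [Finset.mem_image, Finset.mem_product]
  constructor
  · rintro ⟨a, ha, b, hb, rfl⟩
    exact ⟨(a, b), ⟨ha, hb⟩, rfl⟩
  · rintro ⟨p, hp, rfl⟩
    exact ⟨p.1, hp.1, p.2, hp.2, rfl⟩

theorem mainStep_of_not_dense {H : SimpleGraph (Fin n)} {L : List (List (Fin n) × List (Fin n))}
    (hd : isDense n (numEdgesE (adjacency H)).val = false) :
    mainStep (adjacency H, L) = (adjacency H, L) := by
  simp [mainStep, hd]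

theorem mainStep_of_dense {H : SimpleGraph (Fin n)} {L : List (List (Fin n) × List (Fin n))}
    {m : ℕ} (hm : (numEdgesE (adjacency H)).val = m) (hd : isDense n m = true)
    (hp : GoodParams n m (qParam n m) (rParam n m)) :
    ∃ K : List (Fin n) × List (Fin n), IsBalancedPair K ∧ K.1.length = qParam n m ∧
      edges (toFinsets K) ⊆ H.edgeSet ∧
      mainStep (adjacency H, L) = (adjacency (H.deleteEdges (edges (toFinsets K))), K :: L) := by
  obtain ⟨K, h1, h2, h3, h4⟩ := findBipartite_spec H hm hp
  refine ⟨K, h2, h3, h4, ?_⟩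
  simp only [mainStep, hm, hd, cond_true, h1, List.foldl_cons, List.foldl_nil]
  rw [val_deleteE, ← listedEdges_product, ← foldl_deletePair]
  rfl

/-- On graphs with `n` vertices, the parameters are good whenever they are used. -/
def IsLarge (n : ℕ) : Prop :=
  4 ≤ n ∧ ∀ m, 2 * m ≤ n ^ 2 → isDense n m = true → GoodParams n m (qParam n m) (rParam n m)

theorem complexity_cons_pair {K : List (Fin n) × List (Fin n)} (hK : IsBalancedPair K)
    (L : List (List (Fin n) × List (Fin n))) :
    complexity ((K :: L).map toFinsets) = 2 * K.1.length + complexity (L.map toFinsets) := by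
  simp only [complexity, List.map_cons, List.sum_cons, hK.card_fst, hK.card_snd]
  ring

/-- The quantity bounded by `B` is an amortised cost that no round increases. The hypothesis `hl`
says that enough rounds remain or the loop has already become idle; each effective round deletes at
least one edge. -/
theorem mainLoop_spec (hn : IsLarge n) {G : SimpleGraph (Fin n)} {β : Type*} (l : List β)
    (H : SimpleGraph (Fin n)) (L : List (List (Fin n) × List (Fin n)))
    (h : IsPartialDecomposition G H (L.map toFinsets)) (B : ℝ)
    (hl : (numEdgesE (adjacency H)).val ≤ l.length ∨
      isDense n (numEdgesE (adjacency H)).val = false)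
    (hB : log ((n : ℝ) / 2) * complexity (L.map toFinsets) +
      4 * potential (2 * exp 1 * n ^ 2) (numEdgesE (adjacency H)).val ≤ B) :
    ∃ (H' : SimpleGraph (Fin n)) (L' : List (List (Fin n) × List (Fin n))),
      l.foldl (fun s _ => mainStep s) (adjacency H, L) = (adjacency H', L') ∧
      IsPartialDecomposition G H' (L'.map toFinsets) ∧
      isDense n (numEdgesE (adjacency H')).val = false ∧
      log ((n : ℝ) / 2) * complexity (L'.map toFinsets) +
        4 * potential (2 * exp 1 * n ^ 2) (numEdgesE (adjacency H')).val ≤ B := by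
  induction l generalizing H L with
  | nil =>
    refine ⟨H, L, rfl, h, ?_, hB⟩
    rcases hl with hl | hl
    · rw [Nat.le_zero.1 hl]
      exact isDense_zero (by have := hn.1; omega)
    · exact hl
  | cons x l ih =>
    rw [List.foldl_cons]
    cases hd : isDense n (numEdgesE (adjacency H)).val
    · rw [mainStep_of_not_dense hd]
      exact ih H L h (Or.inr hd) hB
    · have hp := hn.2 _ (two_mul_numEdges_le H) hd
      obtain ⟨K, hK, hlen, hsub, heq⟩ := mainStep_of_dense (L := L) rfl hd hp
      rw [heq]
      have hcard := card_edges_toFinsets hK hsub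
      have hpos := hK.length_pos
      refine ih _ (K :: L) (hK.cons h hsub) (Or.inl ?_) ?_
      · rcases hl with hl | hl
        · rw [List.length_cons] at hl
          have hdec : ∀ a b c d : ℕ, b + c = a → 1 ≤ c → a ≤ d + 1 → b ≤ d := by omega
          exact hdec _ _ _ _ hcard (Nat.one_le_pow _ _ hpos) hl
        · rw [hd] at hl; exact absurd hl (by simp)
      · refine le_trans ?_ hB
        rw [complexity_cons_pair hK]
        rw [← hlen] at hp
        have hq := hp.q_large
        have hn0 : (0 : ℝ) < n := by exact_mod_cast hp.n_pos
        have hm0 : (0 : ℝ) < (numEdgesE (adjacency H)).val := by exact_mod_cast hp.m_pos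
        have hcardR : ((numEdgesE (adjacency (H.deleteEdges (edges (toFinsets K))))).val : ℝ) +
          (K.1.length : ℝ) ^ 2 = (numEdgesE (adjacency H)).val := by exact_mod_cast hcard
        set m := (numEdgesE (adjacency H)).val
        set m' := (numEdgesE (adjacency (H.deleteEdges (edges (toFinsets K))))).val
        have hpot := potential_sub_ge (A := 2 * exp 1 * (n : ℝ) ^ 2) (t := m') (m := m)
          (by positivity) (by positivity) (by nlinarith) hm0
        have hdiff : (m : ℝ) - m' = (K.1.length : ℝ) ^ 2 := by linarith
        rw [hdiff] at hpot
        have hk : (0 : ℝ) ≤ K.1.length := by positivity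
        -- With `k` vertices in each part, the complexity term grows by `2k log(n/2) ≤ 4k²
        -- log(A/m)`. As `m - m' = k²`, four times the drop of the potential pays for this.
        have hmul := mul_le_mul_of_nonneg_left hq hk
        push_cast
        nlinarith

theorem val_findDecomposition (n₀ : ℕ) (M : Den n .matrix) :
    (findDecomposition n₀ (Den n) M).val =
      bif decide (n < n₀) then (bruteForce M).val
      else
        let s := (List.range (numEdgesE M).val).foldl (fun s _ => mainStep s) (M, [])
        (singleEdgesE (rep := Den n) s.1 (.var s.2)).val := by
  simp only [findDecomposition, Expr.val, val_lengthE, List.length_finRange]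
  simp only [val_singleEdgesE, Expr.val, val_deleteE]
  simp only [mainStep, val_deleteE, Expr.val]

theorem findDecomposition_spec {n₀ : ℕ} (hn : IsLarge n) (hn₀ : n₀ ≤ n) (G : SimpleGraph (Fin n)) :
    IsBalancedDecomposition G (output n₀ G) ∧
      (complexity (output n₀ G) : ℝ) ≤ (2 + 16 * exp 1) * ((n : ℝ) ^ 2 / log n) := by
  have hout : output n₀ G = (findDecomposition n₀ (Den n) (adjacency G)).val.map toFinsets := rfl
  rw [hout, val_findDecomposition, decide_eq_false (by omega), cond_false]
  obtain ⟨H, L, h1, h2, h3, h4⟩ := mainLoop_spec hn (G := G)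
    (List.range (numEdgesE (adjacency G)).val) G [] (isPartialDecomposition_nil G) _
    (Or.inl (by simp)) le_rfl
  simp only
  rw [h1]
  obtain ⟨h5, h6⟩ := singleEdges_spec h2 (.var (L : Den n (.list (.prod (.list .vertex)
    (.list .vertex))))) rfl
  refine ⟨h5, ?_⟩
  rw [h6]
  have hn4 : (4 : ℝ) ≤ n := by exact_mod_cast hn.1
  have he := exp_pos 1
  have hlog : 0 < log (n : ℝ) := log_pos (by linarith)
  -- Equivalent to `n ≤ (n/2)²`, which is where `n ≥ 4` enters.
  have hhalf : log (n : ℝ) ≤ 2 * log ((n : ℝ) / 2) := by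
    rw [← Real.log_rpow (by linarith), Real.rpow_two]
    exact log_le_log (by linarith) (by nlinarith)
  have hm : ((numEdgesE (adjacency H)).val : ℝ) ≤ (n : ℝ) ^ 2 / log n := by
    simpa [isDense] using h3
  have hA : (0 : ℝ) < 2 * exp 1 * (n : ℝ) ^ 2 := by positivity
  have hmA : ((numEdgesE (adjacency H)).val : ℝ) ≤ 2 * exp 1 * (n : ℝ) ^ 2 := by
    have : (2 : ℝ) * (numEdgesE (adjacency H)).val ≤ n ^ 2 := by
      exact_mod_cast two_mul_numEdges_le H
    nlinarith [add_one_le_exp (1 : ℝ), sq_nonneg (n : ℝ)]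
  have hp0 := potential_nonneg hmA (by positivity)
  have hp1 := potential_le hA (t := (numEdgesE (adjacency G)).val) (by positivity)
  simp only [complexity, List.map_nil, List.sum_nil, Nat.cast_zero, mul_zero, zero_add] at h4
  change log ((n : ℝ) / 2) * (complexity (L.map toFinsets) : ℝ) + _ ≤ _ at h4
  set c := complexity (L.map toFinsets)
  have hc0 : (0 : ℝ) ≤ c := by positivity
  -- The initial potential is at most `2en²`, so `log(n/2) * c ≤ 8en²`; passing from `log(n/2)` to
  -- `log n` doubles the constant.
  have hc : (c : ℝ) ≤ 16 * exp 1 * ((n : ℝ) ^ 2 / log n) := by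
    rw [← mul_div_assoc, le_div_iff₀ hlog]
    nlinarith
  push_cast
  linarith

end MainLoop

/-! ### Running time -/

section Cost

variable {n : ℕ} {a : Ty}

/-- The bound on a round is required only in states that are really reached, namely after a prefix
of the list; the cost in an arbitrary state may be unbounded. -/
theorem loopCost_le {α σ : Type} {step : σ → α → σ} {c : σ → α → ℕ} {s : σ} {l : List α} {k B : ℕ}
    (hk : l.length ≤ k)
    (h : ∀ l₁ x l₂, l = l₁ ++ x :: l₂ → c (l₁.foldl step s) x ≤ B) :
    loopCost step c s l ≤ k * (B + 1) := by
  refine le_trans ?_ (Nat.mul_le_mul_right (B + 1) hk)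
  clear hk
  induction l generalizing s with
  | nil => simp [loopCost]
  | cons x l ih =>
    have h1 : c s x ≤ B := h [] x l rfl
    have h2 := ih (s := step s x) fun l₁ y l₂ hl => h (x :: l₁) y l₂ (by rw [hl]; rfl)
    rw [loopCost, List.length_cons, Nat.succ_mul]
    omega

theorem loopCost_le_of_invariant {α σ : Type} {step : σ → α → σ} {c : σ → α → ℕ} {s : σ}
    {l : List α} {k B : ℕ} (I : σ → Prop) (hk : l.length ≤ k) (h0 : I s)
    (hstep : ∀ s, ∀ x ∈ l, I s → I (step s x)) (hc : ∀ s, ∀ x ∈ l, I s → c s x ≤ B) :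
    loopCost step c s l ≤ k * (B + 1) := by
  refine loopCost_le hk fun l₁ x l₂ hl => hc _ x (by simp [hl]) ?_
  have : ∀ y ∈ l₁, y ∈ l := fun y hy => by simp [hl, hy]
  clear hl
  induction l₁ generalizing s with
  | nil => exact h0
  | cons y l₁ ih =>
    rw [List.foldl_cons]
    exact ih (hstep _ _ (this y (by simp)) h0) fun z hz => this z (by simp [hz])

theorem cost_foldl_le_of_prefix {σ : Ty} (l : Expr (Den n) (.list a)) (init : Expr (Den n) σ)
    (f : Den n σ → Den n a → Expr (Den n) σ) {k B : ℕ} (hk : l.val.length ≤ k)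
    (h : ∀ l₁ x l₂, l.val = l₁ ++ x :: l₂ →
      (f (l₁.foldl (fun s x => (f s x).val) init.val) x).cost ≤ B) :
    (Expr.foldl l init f).cost ≤ 1 + l.cost + init.cost + k * (B + 1) := by
  rw [Expr.cost]
  exact Nat.add_le_add_left (loopCost_le hk h) _

theorem cost_foldl_le_of_invariant {σ : Ty} (l : Expr (Den n) (.list a)) (init : Expr (Den n) σ)
    (f : Den n σ → Den n a → Expr (Den n) σ) {k B : ℕ} (I : Den n σ → Prop)
    (hk : l.val.length ≤ k) (h0 : I init.val)
    (hstep : ∀ s, ∀ x ∈ l.val, I s → I (f s x).val)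
    (hc : ∀ s, ∀ x ∈ l.val, I s → (f s x).cost ≤ B) :
    (Expr.foldl l init f).cost ≤ 1 + l.cost + init.cost + k * (B + 1) := by
  rw [Expr.cost]
  exact Nat.add_le_add_left (loopCost_le_of_invariant I hk h0 hstep hc) _

theorem cost_foldl_le {σ : Ty} (l : Expr (Den n) (.list a)) (init : Expr (Den n) σ)
    (f : Den n σ → Den n a → Expr (Den n) σ) {k B : ℕ} (hk : l.val.length ≤ k)
    (hc : ∀ s, ∀ x ∈ l.val, (f s x).cost ≤ B) :
    (Expr.foldl l init f).cost ≤ 1 + l.cost + init.cost + k * (B + 1) :=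
  cost_foldl_le_of_invariant l init f (fun _ => True) hk trivial (fun _ _ _ _ => trivial)
    fun s x hx _ => hc s x hx

theorem cost_ite_le (b : Expr (Den n) .bool) {s t : Expr (Den n) a} {B : ℕ} (hs : s.cost ≤ B)
    (ht : t.cost ≤ B) : (Expr.ite b s t).cost ≤ 1 + b.cost + B := by
  rw [Expr.cost]
  refine Nat.add_le_add_left ?_ _
  cases b.val
  · exact ht
  · exact hs

theorem cost_andE_le (s t : Expr (Den n) .bool) : (andE s t).cost ≤ 2 + s.cost + t.cost := by
  have := cost_ite_le s (s := t) (t := .ff) (B := t.cost + 1) (by omega) (by simp [Expr.cost])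
  rw [andE]; omega

theorem cost_orE_le (s t : Expr (Den n) .bool) : (orE s t).cost ≤ 2 + s.cost + t.cost := by
  have := cost_ite_le s (s := .tt) (t := t) (B := t.cost + 1) (by simp [Expr.cost]) (by omega)
  rw [orE]; omega

theorem cost_countE_le (l : Expr (Den n) (.list a)) (p : Den n a → Expr (Den n) .bool) {k B : ℕ}
    (hk : l.val.length ≤ k) (hp : ∀ x ∈ l.val, (p x).cost ≤ B) :
    (countE l p).cost ≤ 2 + l.cost + k * (B + 5) := by
  refine (cost_foldl_le l _ _ (B := B + 4) hk fun s x hx => ?_).trans ?_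
  · refine (cost_ite_le (p x) (B := 3) (by simp [Expr.cost]) (by simp [Expr.cost])).trans ?_
    have := hp x hx
    omega
  · simp only [Expr.cost]; linarith

theorem cost_lengthE_le (l : Expr (Den n) (.list a)) {k : ℕ} (hk : l.val.length ≤ k) :
    (lengthE l).cost ≤ 2 + l.cost + k * 4 := by
  refine (cost_foldl_le l _ _ (B := 3) hk fun s x hx => by simp [Expr.cost]).trans ?_
  simp only [Expr.cost]; linarith

theorem cost_reverseE_le (l : Expr (Den n) (.list a)) {k : ℕ} (hk : l.val.length ≤ k) :
    (reverseE l).cost ≤ 2 + l.cost + k * 4 := by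
  refine (cost_foldl_le l _ _ (B := 3) hk fun s x hx => by simp [Expr.cost]).trans ?_
  simp only [Expr.cost]; linarith

theorem cost_filterE_le (l : Expr (Den n) (.list a)) (p : Den n a → Expr (Den n) .bool) {k B : ℕ}
    (hk : l.val.length ≤ k) (hp : ∀ x ∈ l.val, (p x).cost ≤ B) :
    (filterE l p).cost ≤ 4 + l.cost + k * (B + 9) := by
  rw [filterE]
  refine (cost_reverseE_le _ (k := k) ?_).trans ?_
  · have := val_filterE (n := n) l p
    rw [filterE, val_reverseE] at this
    rw [← List.length_reverse, this]
    exact (List.length_filter_le _ _).trans hk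
  · have := cost_foldl_le (n := n) l (.nil) (fun acc x => .ite (p x) (.cons (.var x) (.var acc))
      (.var acc)) (B := B + 4) hk fun s x hx => by
        refine (cost_ite_le (p x) (B := 3) (by simp [Expr.cost]) (by simp [Expr.cost])).trans ?_
        have := hp x hx
        omega
    have hnil : (Expr.nil (rep := Den n) (a := a)).cost = 1 := by simp only [Expr.cost]
    linarith

theorem cost_takeE_le (q : ℕ) (l : Expr (Den n) (.list a)) {k : ℕ} (hk : l.val.length ≤ k) :
    (takeE (rep := Den n) q l).cost ≤ 4 + l.cost + k * (4 * q + 14) := by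
  rw [takeE]
  refine (cost_reverseE_le _ (k := k) ?_).trans ?_
  · have := val_takeE (n := n) q l
    rw [takeE, val_reverseE] at this
    rw [← List.length_reverse, this]
    exact (List.length_take_le' _ _).trans hk
  -- Each round measures the accumulated list, which stays affordable because its length never
  -- exceeds `q`.
  · have := cost_foldl_le_of_invariant (n := n) l .nil (fun acc x =>
      .ite (.lt (lengthE (.var acc)) (.var q)) (.cons (.var x) (.var acc)) (.var acc))
      (B := 4 * q + 9) (fun s => List.length s ≤ q) hk (by simp [Expr.val]) (fun s x hx hs => by
        simp only [Expr.val, val_lengthE]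
        by_cases h : List.length s < q
        · simp [h]
        · simpa [h] using hs)
      (fun s x hx hs => by
        refine (cost_ite_le _ (B := 3) (by simp [Expr.cost]) (by simp [Expr.cost])).trans ?_
        have h1 := cost_lengthE_le (n := n) (.var s) (k := q) hs
        simp only [Expr.cost] at h1 ⊢
        omega)
    have hnil : (Expr.nil (rep := Den n) (a := a)).cost = 1 := by simp only [Expr.cost]
    linarith

theorem cost_allE_le (l : Expr (Den n) (.list a)) (p : Den n a → Expr (Den n) .bool) {k B : ℕ}
    (hk : l.val.length ≤ k) (hp : ∀ x ∈ l.val, (p x).cost ≤ B) :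
    (allE l p).cost ≤ 2 + l.cost + k * (B + 4) := by
  refine (cost_foldl_le l _ _ (B := B + 3) hk fun s x hx => ?_).trans ?_
  · refine (cost_andE_le _ _).trans ?_
    have := hp x hx
    simp only [Expr.cost]
    omega
  · simp only [Expr.cost]; linarith

theorem cost_memE_le (v : Fin n) (l : Expr (Den n) (.list .vertex)) {k : ℕ}
    (hk : l.val.length ≤ k) : (memE (rep := Den n) v l).cost ≤ 2 + l.cost + k * 9 := by
  refine (cost_foldl_le l _ _ (B := 8) hk fun s x hx => ?_).trans ?_
  · refine (cost_orE_le _ _).trans ?_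
    simp [Expr.cost]
  · simp only [Expr.cost]; linarith

theorem cost_edgeE_le (M : Den n .matrix) (u v : Fin n) :
    (edgeE (rep := Den n) M u v).cost ≤ 11 := by
  refine (cost_andE_le _ _).trans ?_
  simp [Expr.cost]

theorem length_vertices : (Expr.vertices (rep := Den n)).val.length ≤ n := by
  simp [Expr.val]

theorem cost_numEdgesE_le (M : Den n .matrix) :
    (numEdgesE M).cost ≤ 3 + n + n * (4 + n + n * 16) := by
  refine (cost_foldl_le _ _ _ (B := 3 + n + n * 16) length_vertices fun k u _ => ?_).trans ?_
  · refine (cost_foldl_le _ _ _ (B := 15) length_vertices fun k v _ => ?_).trans ?_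
    · refine (cost_ite_le _ (B := 3) (by simp [Expr.cost]) (by simp [Expr.cost])).trans ?_
      have h1 := cost_edgeE_le M u v
      omega
    · simp only [Expr.cost]; linarith
  · simp only [Expr.cost]; linarith

theorem cost_singleEdgesE_le (M : Den n .matrix)
    (acc : Expr (Den n) (.list (.prod (.list .vertex) (.list .vertex)))) :
    (singleEdgesE M acc).cost ≤ 2 + n + acc.cost + n * (4 + n + n * 22) := by
  refine (cost_foldl_le _ _ _ (B := 3 + n + n * 22) length_vertices fun k u _ => ?_).trans ?_
  · refine (cost_foldl_le _ _ _ (B := 21) length_vertices fun k v _ => ?_).trans ?_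
    · refine (cost_ite_le _ (B := 9) (by simp [Expr.cost]) (by simp [Expr.cost])).trans ?_
      have h1 := cost_edgeE_le M u v
      omega
    · simp only [Expr.cost]; linarith
  · simp only [Expr.cost]; linarith

theorem cost_degreeE_le (M : Den n .matrix) (v : Fin n) :
    (degreeE (rep := Den n) M v).cost ≤ 3 + n * 10 := by
  refine (cost_countE_le _ _ (B := 4) length_vertices fun x _ => by simp [Expr.cost]).trans ?_
  simp only [Expr.cost]; linarith

theorem cost_rankE_le (M : Den n .matrix) (v : Fin n) :
    (rankE (rep := Den n) M v).cost ≤ 7 + n * 11 + n * (n * 10 + 24) := by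
  have h1 := cost_degreeE_le M v
  rw [rankE, Expr.cost]
  refine (Nat.add_le_add_left (cost_countE_le _ _ (B := n * 10 + 19) length_vertices
    fun u _ => ?_) _).trans ?_
  · have h2 := cost_degreeE_le M u
    rw [Expr.cost]
    refine (Nat.add_le_add_left ((cost_orE_le _ _).trans
      (Nat.add_le_add_left (cost_andE_le _ _) _)) _).trans ?_
    simp only [Expr.cost]
    omega
  · simp only [Expr.cost]; linarith

/-- A bound for the cost of `topDegreeE`. -/
def topDegreeBound (n : ℕ) : ℕ := 5 + n + n * (18 + n * 11 + n * (n * 10 + 24))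

theorem cost_topDegreeE_le (M : Den n .matrix) (r : ℕ) :
    (topDegreeE (rep := Den n) M r).cost ≤ topDegreeBound n := by
  refine (cost_filterE_le _ _ (B := 9 + n * 11 + n * (n * 10 + 24)) length_vertices
    fun v _ => ?_).trans ?_
  · have := cost_rankE_le M v
    simp only [Expr.cost]
    omega
  · simp only [Expr.cost, topDegreeBound]; linarith

theorem cost_lengthE_var_le (S : Den n (.list a)) {k : ℕ} (hS : S.length ≤ k) :
    (lengthE (rep := Den n) (.var S)).cost ≤ 3 + k * 4 := by
  have := cost_lengthE_le (n := n) (.var S) hS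
  simp only [Expr.cost] at this
  omega

/-- A bound for the cost of `subsetsE`. -/
def subsetsBound (n : ℕ) : ℕ := 9 + n * (4 + n * (n * 4 + 12)) + n * (n * 4 + 14)

theorem cost_subsetsE_le {m q r : ℕ} (h : GoodParams n m q r) (R : List (Fin n))
    (hR : R.length ≤ r) : (subsetsE (rep := Den n) q R).cost ≤ subsetsBound n := by
  -- After a prefix `R'` the state consists of the collected subsets of `R'`, so the counting bound
  -- applies to every intermediate state and not only to the last.
  have hval : ∀ R' : List (Fin n), R'.foldl (fun (acc : List (List (Fin n))) (x : Fin n) =>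
      (Expr.foldl (rep := Den n) (a := .list .vertex) (s := .list (.list .vertex)) (.var acc)
        (.var acc) fun acc' S => .ite (.lt (lengthE (.var S)) (.var q))
          (.cons (.cons (.var x) (.var S)) (.var acc')) (.var acc')).val) [[]] =
      collectSubsets q R' := by
    intro R'
    simp only [Expr.val, val_lengthE, collectSubsets]
    congr 1
    funext acc x
    exact foldl_cons_if (fun S : List (Fin n) => decide (S.length < q)) (x :: ·) acc acc
  have hS : ∀ R' : List (Fin n), ∀ S ∈ collectSubsets q R', S.length ≤ n := fun R' S hS =>
    (mem_collectSubsets.1 hS).2.trans h.q_le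
  refine (cost_filterE_le (n := n) _ _ (k := n) (B := 5 + n * 4) ?_ fun S hSm => ?_).trans ?_
  · rw [Expr.val]
    exact (congrArg List.length (hval R)).trans_le (length_collectSubsets_le h hR)
  · have hSm : S ∈ collectSubsets q R := by
      rw [Expr.val] at hSm
      rw [← hval R]; exact hSm
    have := cost_lengthE_var_le (n := n) (a := .vertex) S (hS R S hSm)
    simp only [Expr.cost]
    omega
  · have := cost_foldl_le_of_prefix (n := n) (a := .vertex) (.var R)
      (.cons .nil .nil : Expr (Den n) (.list (.list .vertex)))
      (fun acc x => .foldl (.var acc) (.var acc) fun acc' S =>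
        .ite (.lt (lengthE (.var S)) (.var q))
          (.cons (.cons (.var x) (.var S)) (.var acc')) (.var acc'))
      (k := n) (B := 3 + n * (n * 4 + 12)) (hR.trans h.r_le) fun l₁ x l₂ hl => by
        have hl : R = l₁ ++ x :: l₂ := hl
        have hl₁ : l₁.length ≤ r := by
          rw [hl, List.length_append] at hR; omega
        have hv := hval l₁
        simp only [Expr.val] at hv ⊢
        rw [hv]
        refine (cost_foldl_le (n := n) _ _ _ (k := n) (B := n * 4 + 11) ?_ fun acc' S hSm => ?_).trans
          ?_
        · simp only [Expr.val]
          exact length_collectSubsets_le h hl₁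
        · refine (cost_ite_le _ (B := 5) (by simp [Expr.cost]) (by simp [Expr.cost])).trans ?_
          simp only [Expr.val] at hSm
          have := cost_lengthE_var_le (n := n) (a := .vertex) S (hS l₁ S hSm)
          simp only [Expr.cost]
          omega
        · simp only [Expr.cost]; linarith
    have hR : (Expr.var (rep := Den n) (a := .list .vertex) R).cost = 1 := by simp only [Expr.cost]
    have hnil : (Expr.cons (rep := Den n) (a := .list .vertex) .nil .nil).cost = 3 := by
      simp only [Expr.cost]
    rw [subsetsBound]
    linarith

/-- A bound for the cost of `commonE`. -/
def commonBound (n : ℕ) : ℕ := 5 + n + n * (n * 17 + 17)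

theorem cost_commonE_le (M : Den n .matrix) (R C : List (Fin n)) (hR : R.length ≤ n)
    (hC : C.length ≤ n) : (commonE (rep := Den n) M R C).cost ≤ commonBound n := by
  refine (cost_filterE_le _ _ (B := n * 17 + 8) length_vertices fun w _ => ?_).trans ?_
  · refine (cost_ite_le _ (B := 3 + n * 8) (by simp only [Expr.cost]; omega) ?_).trans ?_
    · refine (cost_allE_le _ _ (k := n) (B := 4) (by simpa only [Expr.val] using hC) fun v _ => by
        simp [Expr.cost]).trans ?_
      simp only [Expr.cost]; omega
    · have := cost_memE_le (n := n) w (.var R) (k := n) (by simpa only [Expr.val] using hR)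
      simp only [Expr.cost] at this
      omega
  · simp only [Expr.cost, commonBound]; linarith

/-- A bound for the cost of `findBipartite`. -/
def findBipartiteBound (n : ℕ) : ℕ :=
  11 + topDegreeBound n + subsetsBound n + n * (31 + commonBound n + n * 4 + n * (n * 4 + 14))

theorem cost_findBipartite_le (M : Den n .matrix) (m : ℕ)
    (h : GoodParams n m (qParam n m) (rParam n m)) :
    (findBipartite (rep := Den n) M n m).cost ≤ findBipartiteBound n := by
  simp only [findBipartite, Expr.cost, Expr.val]
  have hRlen := length_topDegreeE M h.r_le
  have hR := hRlen.trans_le h.r_le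
  have h1 := cost_topDegreeE_le M (rParam n m)
  set R : List (Fin n) := (topDegreeE M (rParam n m)).val with hRdef
  have h2 := cost_subsetsE_le h R hRlen.le
  have hlen : (subsetsE (rep := Den n) (qParam n m) R).val.length ≤ n := by
    rw [val_subsetsE]
    exact (List.length_filter_le _ _).trans (length_collectSubsets_le h hRlen.le)
  have h3 := cost_foldl_le_of_invariant (n := n) (subsetsE (rep := Den n) (qParam n m) R)
    (.nil : Expr (Den n) (.list (.prod (.list .vertex) (.list .vertex))))
    (fun res C => .ite (.eq (lengthE (.var res)) (.lit 0))
      (.letE (commonE M R C) fun D =>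
        .ite (.lt (lengthE (.var D)) (.var (qParam n m))) .nil
          (.cons (.pair (.var C) (takeE (rep := Den n) (qParam n m) (.var D))) .nil))
      (.var res)) (k := n) (B := 30 + commonBound n + n * 4 + n * (n * 4 + 14))
    (fun res => List.length res ≤ 1) hlen (by simp [Expr.val]) (fun res C hC hres => by
      simp only [Expr.val, val_lengthE]
      by_cases h0 : List.length res = 0
      · by_cases h1 : List.length (commonE M R C).val < qParam n m <;> simp [h0, h1]
      · simpa [h0] using hres)
    (fun res C hC hres => by
      have hCn : List.length C ≤ n := by
        rw [val_subsetsE, List.mem_filter, mem_collectSubsets] at hC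
        exact hC.1.2.trans h.q_le
      have hcommon := cost_commonE_le M R C hR hCn
      have hD : List.length (commonE M R C).val ≤ n := by
        rw [val_commonE]
        simpa using List.length_filter_le _ (List.finRange n)
      refine (cost_ite_le _ (B := 18 + commonBound n + n * 4 + n * (n * 4 + 14)) ?_
        (by simp only [Expr.cost]; omega)).trans ?_
      · rw [Expr.cost]
        have htake := cost_takeE_le (n := n) (qParam n m) (.var (commonE M R C).val) (k := n) hD
        have hq : n * (4 * qParam n m + 14) ≤ n * (n * 4 + 14) := by
          have := h.q_le
          exact Nat.mul_le_mul_left _ (by omega)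
        have hDl := cost_lengthE_var_le (commonE M R C).val hD
        refine (Nat.add_le_add_left (cost_ite_le _ (B := 9 + n * (n * 4 + 14)) ?_ ?_) _).trans ?_
        · simp only [Expr.cost]; omega
        · simp only [Expr.cost] at htake ⊢; omega
        · simp only [Expr.cost]; omega
      · have := cost_lengthE_var_le res hres
        simp only [Expr.cost]
        omega)
  simp only [Expr.cost, Expr.val] at h3
  rw [findBipartiteBound]
  linarith

theorem cost_deleteE_le (M : Expr (Den n) .matrix) (K : List (Fin n) × List (Fin n))
    (h1 : K.1.length ≤ n) (h2 : K.2.length ≤ n) :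
    (deleteE (rep := Den n) M K).cost ≤ 3 + M.cost + n * (n * 10 + 5) := by
  refine (cost_foldl_le _ _ _ (k := n) (B := 4 + n * 10) (by simpa only [Expr.val] using h1)
    fun M a _ => ?_).trans ?_
  · refine (cost_foldl_le _ _ _ (k := n) (B := 9) (by simpa only [Expr.val] using h2)
      fun M b _ => by simp [Expr.cost]).trans ?_
    simp only [Expr.cost]; linarith
  · simp only [Expr.cost]; linarith

/-- The body of the main loop of FIND-DECOMPOSITION. -/
def roundE {rep : Ty → Type} (n : rep .nat)
    (s : rep (.prod .matrix (.list (.prod (.list .vertex) (.list .vertex))))) :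
    Expr rep (.prod .matrix (.list (.prod (.list .vertex) (.list .vertex)))) :=
  .letE (.fst (.var s)) fun M =>
  .letE (numEdgesE M) fun m =>
  .ite (.dense (.var n) (.var m))
    (.foldl (findBipartite M n m) (.var s) fun s K =>
      .pair (deleteE (.fst (.var s)) K) (.cons (.var K) (.snd (.var s))))
    (.var s)

theorem val_roundE (s : Den n (.prod .matrix (.list (.prod (.list .vertex) (.list .vertex))))) :
    (roundE (rep := Den n) n s).val = mainStep s := by
  simp only [roundE, Expr.val, mainStep, val_deleteE]

/-- A bound for the cost of one round. -/
def roundBound (n : ℕ) : ℕ :=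
  24 + n + n * (4 + n + n * 16) + findBipartiteBound n + n * (n * 10 + 5)

theorem cost_roundE_le (hn : IsLarge n) (H : SimpleGraph (Fin n))
    (L : List (List (Fin n) × List (Fin n))) :
    (roundE (rep := Den n) n (adjacency H, L)).cost ≤ roundBound n := by
  have hnum := cost_numEdgesE_le (adjacency H)
  simp only [roundE, Expr.cost, Expr.val]
  rw [roundBound]
  cases hd : isDense n (numEdgesE (adjacency H)).val
  · simp only [cond_false]
    omega
  · have hp := hn.2 _ (two_mul_numEdges_le H) hd
    have hb := cost_findBipartite_le (adjacency H) _ hp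
    -- Exactly one pair is returned, with parts of size `q ≤ n`, so the inner loop performs a single
    -- deletion.
    obtain ⟨K, hK, hKb, hKl, -⟩ := findBipartite_spec H rfl hp
    have hK1 : K.1.length ≤ n := hKl.trans_le hp.q_le
    have hK2 : K.2.length ≤ n := hKb.length_eq.symm.trans_le hK1
    have hdel := cost_deleteE_le (n := n) (.fst (.var (a := .prod .matrix
      (.list (.prod (.list .vertex) (.list .vertex)))) (adjacency H, L))) K hK1 hK2
    simp only [Expr.cost] at hdel
    rw [hK]
    simp only [cond_true, loopCost]
    omega

/-- A bound for the cost of FIND-DECOMPOSITION on large graphs. -/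
def decompositionBound (n : ℕ) : ℕ :=
  24 + n * 7 + n * (4 + n + n * 16) + n * n + n * n * (roundBound n + 1) + n * (4 + n + n * 22)

theorem mainStep_adjacency (hn : IsLarge n) (H : SimpleGraph (Fin n))
    (L : List (List (Fin n) × List (Fin n))) :
    ∃ H' L', mainStep (adjacency H, L) = (adjacency H', L') := by
  cases hd : isDense n (numEdgesE (adjacency H)).val
  · exact ⟨H, L, mainStep_of_not_dense hd⟩
  · obtain ⟨K, -, -, -, h⟩ := mainStep_of_dense (L := L) rfl hd
      (hn.2 _ (two_mul_numEdges_le H) hd)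
    exact ⟨_, _, h⟩

theorem runningTime_le {n₀ : ℕ} (hn : IsLarge n) (hn₀ : n₀ ≤ n) (G : SimpleGraph (Fin n)) :
    runningTime n₀ G ≤ decompositionBound n := by
  have hfind : findDecomposition n₀ (Den n) (adjacency G) =
      .letE (lengthE .vertices) fun k => .ite (.lt (.var k) (.lit n₀)) (bruteForce (adjacency G))
        (.letE (.foldl (.range (numEdgesE (adjacency G))) (.pair (.var (adjacency G)) .nil)
            fun s _ => roundE k s)
          fun s => .letE (.fst (.var s)) fun M => singleEdgesE M (.snd (.var s))) := rfl
  have hlen : (lengthE (rep := Den n) .vertices).val = n := by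
    rw [val_lengthE, Expr.val, List.length_finRange]
  have hlencost := cost_lengthE_le (n := n) .vertices length_vertices
  have hnum := cost_numEdgesE_le (adjacency G)
  have hm : (numEdgesE (adjacency G)).val ≤ n * n := by
    have := two_mul_numEdges_le G
    rw [sq] at this
    have aux : ∀ a b : ℕ, 2 * a ≤ b → a ≤ b := by omega
    exact aux _ _ this
  -- The invariant is that the current matrix represents a graph, since the bound for a round is
  -- known only for such matrices.
  have hloop := cost_foldl_le_of_invariant (n := n) (.range (numEdgesE (adjacency G)))
    (.pair (.var (adjacency G)) .nil) (fun s _ => roundE (rep := Den n) n s) (k := n * n)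
    (B := roundBound n) (fun s => ∃ H L, s = (adjacency H, L))
    (by simp only [Expr.val, List.length_range]; exact hm)
    ⟨G, [], by simp only [Expr.val]⟩
    (fun s _ _ hs => by
      obtain ⟨H, L, rfl⟩ := hs
      rw [val_roundE]
      exact mainStep_adjacency hn H L)
    (fun s _ _ hs => by
      obtain ⟨H, L, rfl⟩ := hs
      exact cost_roundE_le hn H L)
  have hle : (Expr.lt (rep := Den n) (.var (a := .nat) n) (.lit n₀)).val = false := by
    simp only [Expr.val]
    exact decide_eq_false (Nat.not_lt.2 hn₀)
  rw [runningTime, hfind, Expr.cost, hlen, Expr.cost, hle, cond_false, Expr.cost]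
  generalize (Expr.foldl (.range (numEdgesE (adjacency G))) (.pair (.var (adjacency G)) .nil)
    (fun s _ => roundE (rep := Den n) n s)) = e at hloop ⊢
  have hsingle := cost_singleEdgesE_le (Expr.fst (.var e.val)).val (.snd (.var e.val))
  rw [Expr.cost]
  simp only [Expr.cost] at hloop hlencost hsingle ⊢
  rw [decompositionBound]
  have hm' : @LE.le ℕ _ (numEdgesE (adjacency G)).val (n * n) := hm
  linarith

end Cost

/-! ### The cost bounds are polynomials -/

section Polynomials

/-- A function on the natural numbers that is given by a polynomial. -/
def IsPolynomial (f : ℕ → ℕ) : Prop := ∃ p : Polynomial ℕ, ∀ n, p.eval n = f n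

theorem IsPolynomial.const (k : ℕ) : IsPolynomial fun _ => k := ⟨Polynomial.C k, by simp⟩

theorem IsPolynomial.id : IsPolynomial fun n => n := ⟨Polynomial.X, by simp⟩

theorem IsPolynomial.add {f g : ℕ → ℕ} (hf : IsPolynomial f) (hg : IsPolynomial g) :
    IsPolynomial fun n => f n + g n := by
  obtain ⟨p, hp⟩ := hf
  obtain ⟨q, hq⟩ := hg
  exact ⟨p + q, fun n => by rw [Polynomial.eval_add, hp, hq]⟩

theorem IsPolynomial.mul {f g : ℕ → ℕ} (hf : IsPolynomial f) (hg : IsPolynomial g) :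
    IsPolynomial fun n => f n * g n := by
  obtain ⟨p, hp⟩ := hf
  obtain ⟨q, hq⟩ := hg
  exact ⟨p * q, fun n => by rw [Polynomial.eval_mul, hp, hq]⟩

theorem isPolynomial_decompositionBound : IsPolynomial decompositionBound := by
  unfold decompositionBound roundBound findBipartiteBound commonBound subsetsBound topDegreeBound
  repeat' first
    | exact IsPolynomial.id
    | exact IsPolynomial.const _
    | refine IsPolynomial.add ?_ ?_
    | refine IsPolynomial.mul ?_ ?_

end Polynomials

/-! ### Combining small and large graphs -/

theorem exists_forall_small_le (n₀ : ℕ) (f : ∀ n : ℕ, SimpleGraph (Fin n) → ℝ) :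
    ∃ B : ℝ, 0 ≤ B ∧ ∀ n < n₀, ∀ G : SimpleGraph (Fin n), f n G ≤ B := by
  induction n₀ with
  | zero => exact ⟨0, le_rfl, by simp⟩
  | succ k ih =>
    obtain ⟨B, hB, h⟩ := ih
    -- There are only finitely many graphs on `Fin k`.
    obtain ⟨B', h'⟩ := (Set.finite_range (f k)).bddAbove
    refine ⟨max B B', le_max_of_le_left hB, fun n hn G => ?_⟩
    rcases Nat.lt_succ_iff_lt_or_eq.1 hn with hn | rfl
    · exact (h n hn G).trans (le_max_left _ _)
    · exact (h' ⟨G, rfl⟩).trans (le_max_right _ _)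

theorem exists_isLarge : ∃ N : ℕ, ∀ n, N ≤ n → IsLarge n := by
  obtain ⟨N, hN, h⟩ := eventually_log_bounds
  refine ⟨N, fun n hn => ⟨hN.trans hn, fun m hm hd => ?_⟩⟩
  exact goodParams_of_isDense (hN.trans hn) (h n hn).1 (h n hn).2 hm hd

end Biclique

theorem theorem2 :
    ∃ N : ℕ, ∀ n₀ : ℕ, N ≤ n₀ →
      ∃ (C : ℝ) (p : Polynomial ℕ), ∀ (n : ℕ) (G : SimpleGraph (Fin n)),
        Biclique.IsBalancedDecomposition G (Biclique.output n₀ G) ∧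
        (2 ≤ n →
          (Biclique.complexity (Biclique.output n₀ G) : ℝ) ≤ C * ((n : ℝ) ^ 2 / Real.log (n : ℝ))) ∧
        Biclique.runningTime n₀ G ≤ p.eval n := by
  obtain ⟨N, hN⟩ := Biclique.exists_isLarge
  refine ⟨N, fun n₀ hn₀ => ?_⟩
  -- The ratio to `n² / log n` is bounded over all small graphs; for `n ≤ 1` it is a default value
  -- and is never used.
  obtain ⟨B, hB0, hB⟩ := Biclique.exists_forall_small_le n₀ fun n G =>
    (Biclique.complexity (Biclique.output n₀ G) : ℝ) / ((n : ℝ) ^ 2 / Real.log n)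
  obtain ⟨T, -, hT⟩ := Biclique.exists_forall_small_le n₀ fun _ G =>
    (Biclique.runningTime n₀ G : ℝ)
  obtain ⟨p, hp⟩ := Biclique.isPolynomial_decompositionBound
  -- Sums serve both ranges of `n` at once: the first summand covers `n < n₀`, the second `n ≥ n₀`.
  refine ⟨B + (2 + 16 * Real.exp 1), Polynomial.C ⌈T⌉₊ + p, fun n G => ?_⟩
  have hpos : 2 ≤ n → 0 < (n : ℝ) ^ 2 / Real.log n := fun hn => by
    have : (2 : ℝ) ≤ n := by exact_mod_cast hn
    have := Real.log_pos (show (1 : ℝ) < n by linarith)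
    positivity
  have he := Real.exp_pos 1
  rw [Polynomial.eval_add, Polynomial.eval_C, hp]
  rcases lt_or_ge n n₀ with hn | hn
  · refine ⟨?_, fun hn2 => ?_, ?_⟩
    · have : Biclique.output n₀ G =
          (Biclique.findDecomposition n₀ (Biclique.Den n) (Biclique.adjacency G)).val.map
            Biclique.toFinsets := rfl
      rw [this, Biclique.val_findDecomposition, decide_eq_true hn, cond_true]
      exact Biclique.bruteForce_spec G
    · have h := hB n hn G
      have hx := hpos hn2
      rw [div_le_iff₀ hx] at h
      nlinarith
    · have h : Biclique.runningTime n₀ G ≤ ⌈T⌉₊ := by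
        exact_mod_cast (hT n hn G).trans (Nat.le_ceil T)
      omega
  · have hlarge := hN n (hn₀.trans hn)
    obtain ⟨h1, h2⟩ := Biclique.findDecomposition_spec hlarge hn G
    refine ⟨h1, fun hn2 => h2.trans ?_, ?_⟩
    · have hx := hpos hn2
      nlinarith
    · have := Biclique.runningTime_le hlarge hn G
      omega
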